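/- Let $M$ be a compact smooth manifold without boundary, of dimension $n$, and let $g$ and $\bar g$ be smooth Riemannian metrics on $M$, with Christoffel symbols $\Gamma^k_{pq}$ and $\bar\Gamma^k_{pq}$ in local coordinates. Let $V'=V'(g,\bar g)$ be the DeTurck vector field of $g$ with respect to the reference metric $\bar g$, given in local coordinates by $$(V')^k = g^{pq}\bigl(\Gamma^k_{pq}-\bar\Gamma^k_{pq}\bigr).$$ If $g$ is a stationary point of the DeTurck–Ricci flow, i.e. if $$\mathrm{Ric}(g)+\mathcal{L}_{V'}g=0 \quad\text{on } M,$$ then $V'(g,\bar g)=0$ identically on $M$. (This includes in particular the case where $n=6$, $M$ is oriented and $\bar g$ is a Ricci-flat Kähler metric.) -/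

import Mathlib

open scoped Manifold ContDiff

noncomputable section

namespace RicciDeTurck

/-! ### Tensor calculus in coordinates on open subsets of `ℝⁿ` -/

/-- The partial derivative `∂ᵢ f (y)`. -/
def pderiv {n : ℕ} (i : Fin n) (f : EuclideanSpace ℝ (Fin n) → ℝ)
    (y : EuclideanSpace ℝ (Fin n)) : ℝ :=
  fderiv ℝ f y (EuclideanSpace.single i 1)

/-- The Christoffel symbols
`Γᵏᵢⱼ = ½ ∑ₗ gᵏˡ (∂ᵢ gⱼₗ + ∂ⱼ gᵢₗ - ∂ₗ gᵢⱼ)` of a metric `G y = (gᵢⱼ(y))`. -/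
def christoffel {n : ℕ} (G : EuclideanSpace ℝ (Fin n) → Matrix (Fin n) (Fin n) ℝ)
    (k i j : Fin n) (y : EuclideanSpace ℝ (Fin n)) : ℝ :=
  (1 / 2 : ℝ) * ∑ l, (G y)⁻¹ k l *
    (pderiv i (fun z => G z j l) y + pderiv j (fun z => G z i l) y
      - pderiv l (fun z => G z i j) y)

/-- The components of the Ricci tensor,
`Rᵢⱼ = ∑ₖ (∂ₖ Γᵏᵢⱼ - ∂ᵢ Γᵏₖⱼ) + ∑ₖₗ (Γᵏₖₗ Γˡᵢⱼ - Γᵏᵢₗ Γˡₖⱼ)`. -/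
def ricci {n : ℕ} (G : EuclideanSpace ℝ (Fin n) → Matrix (Fin n) (Fin n) ℝ)
    (i j : Fin n) (y : EuclideanSpace ℝ (Fin n)) : ℝ :=
  ∑ k, (pderiv k (christoffel G k i j) y - pderiv i (christoffel G k k j) y)
    + ∑ k, ∑ l, (christoffel G k k l y * christoffel G l i j y
        - christoffel G k i l y * christoffel G l k j y)

/-- The components of the DeTurck vector field
`Vᵏ = ∑ₚ,q gᵖᑫ (Γᵏₚq - Γ̄ᵏₚq)` of the metric `G` with respect to the metric `G'`. -/
def deTurckVector {n : ℕ} (G G' : EuclideanSpace ℝ (Fin n) → Matrix (Fin n) (Fin n) ℝ)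
    (k : Fin n) (y : EuclideanSpace ℝ (Fin n)) : ℝ :=
  ∑ p, ∑ q, (G y)⁻¹ p q * (christoffel G k p q y - christoffel G' k p q y)

/-- The components of the Lie derivative of the metric `G` along the vector field `∑ₖ Xᵏ ∂ₖ`,
`(L_X g)ᵢⱼ = ∑ₖ (Xᵏ ∂ₖ gᵢⱼ + gₖⱼ ∂ᵢ Xᵏ + gᵢₖ ∂ⱼ Xᵏ)`. -/
def lieDerivMetric {n : ℕ} (X : Fin n → EuclideanSpace ℝ (Fin n) → ℝ)
    (G : EuclideanSpace ℝ (Fin n) → Matrix (Fin n) (Fin n) ℝ)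
    (i j : Fin n) (y : EuclideanSpace ℝ (Fin n)) : ℝ :=
  ∑ k, (X k y * pderiv k (fun z => G z i j) y
    + G y k j * pderiv i (X k) y + G y i k * pderiv j (X k) y)

/-! ### Riemannian metrics on manifolds -/

/-- Smooth Riemannian metrics on the tangent bundle of a smooth `n`-manifold. -/
abbrev Metric (n : ℕ) (M : Type*) [TopologicalSpace M]
    [ChartedSpace (EuclideanSpace ℝ (Fin n)) M] [IsManifold (𝓡 n) ∞ M] :=
  Bundle.ContMDiffRiemannianMetric (𝓡 n) ∞ (EuclideanSpace ℝ (Fin n))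
    (fun x : M => TangentSpace (𝓡 n) x)

section Manifold

variable {n : ℕ} {M : Type*} [TopologicalSpace M]
  [ChartedSpace (EuclideanSpace ℝ (Fin n)) M] [IsManifold (𝓡 n) ∞ M]

/-- The coordinate vector field `∂ᵢ` of the chart `e`, at the point with coordinates `y`. -/
def coordVector (e : OpenPartialHomeomorph M (EuclideanSpace ℝ (Fin n))) (i : Fin n)
    (y : EuclideanSpace ℝ (Fin n)) : TangentSpace (𝓡 n) (e.symm y) :=
  mfderiv (𝓡 n) (𝓡 n) e.symm y (EuclideanSpace.single i (1 : ℝ) : EuclideanSpace ℝ (Fin n))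

/-- The components `gᵢⱼ = g(∂ᵢ, ∂ⱼ)` of the metric `g` in the chart `e`, as functions of the
coordinates. -/
def coordMetric (g : Metric n M) (e : OpenPartialHomeomorph M (EuclideanSpace ℝ (Fin n)))
    (y : EuclideanSpace ℝ (Fin n)) : Matrix (Fin n) (Fin n) ℝ :=
  Matrix.of fun i j => g.inner (e.symm y) (coordVector e i y) (coordVector e j y)

/-- `g` is a stationary point of the DeTurck-Ricci flow with reference metric `g'`:
`Ric(g) + L_V g = 0`, where `V = V(g, g')` is the DeTurck vector field. This equation of tensor
fields is expressed by the equality of components in every smooth chart of `M`. -/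
def IsStationary (g g' : Metric n M) : Prop :=
  ∀ e ∈ IsManifold.maximalAtlas (𝓡 n) ∞ M, ∀ y ∈ e.target, ∀ i j : Fin n,
    ricci (coordMetric g e) i j y
      + lieDerivMetric (deTurckVector (coordMetric g e) (coordMetric g' e))
          (coordMetric g e) i j y = 0

/-- The DeTurck vector field `V(g, g')` vanishes identically on `M`: its components in every
smooth chart of `M` are zero. -/
def DeTurckVectorVanishes (g g' : Metric n M) : Prop :=
  ∀ e ∈ IsManifold.maximalAtlas (𝓡 n) ∞ M, ∀ y ∈ e.target, ∀ k : Fin n,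
    deTurckVector (coordMetric g e) (coordMetric g' e) k y = 0

end Manifold

end RicciDeTurck

end

/-!
Write `V` for the DeTurck vector field of `g` with respect to `g'`. It is first shown to be parallel
for `g`, and then to be zero.

*`V` is parallel.* Take the divergence of `Ric + L_V g = 0` and subtract half the differential of its
trace. By the contracted Bianchi identity (`IsNormalAt.contracted_bianchi`) the Ricci terms cancel,
which leaves `Δ V + Ric(V) = 0` (`IsNormalAt.laplacian_vector`). The equation itself gives
`Ric(V, V) = - V |V|²`, so the Bochner formula becomes `Δ |V|² - 2 V |V|² = 2 |∇V|² ≥ 0`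
(`IsNormalAt.bochner`). Hence `|V|²` is a subsolution of an elliptic operator without zeroth order
term. On a compact manifold the strong maximum principle (`eventually_eq_of_ellipticOp_nonneg`) makes
it constant on each connected component (`eventually_normSqDeTurck_eq_self`), and then `∇V = 0`
(`pderiv_coordDeTurck_eq_zero`).

*`V` vanishes.* The field `V` is minus the tension field of the identity map from `(M, g)` to
`(M, g')`. The stress-energy tensor of this map, `½ tr(g⁻¹ g') g - g'`, therefore has divergence
`g'(V, ·)`. Contracting it with the parallel field `V` gives the vector field
`½ tr(g⁻¹ g') V - g⁻¹ g' V`, whose divergence is `g'(V, V)` (`IsNormalAt.divergence_stressField`).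
By the divergence theorem (`eq_zero_of_divergence_eq`) the nonnegative function `g'(V, V)` is zero.

The pointwise identities are computed in coordinates in which `g` is the identity matrix with
vanishing first derivatives at the given point (`exists_isNormalAt`), and carried to an arbitrary
chart by the transformation laws in the namespace `IsPullbackNear`.
-/

noncomputable section

namespace RicciDeTurck

/-! ### Calculus of partial derivatives -/

section PartialDerivatives

open Filter Topology

variable {n : ℕ} {p : EuclideanSpace ℝ (Fin n)} {f h : EuclideanSpace ℝ (Fin n) → ℝ}

theorem _root_.ContDiffAt.differentiableAt_infty {E F : Type*} [NormedAddCommGroup E]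
    [NormedSpace ℝ E] [NormedAddCommGroup F] [NormedSpace ℝ F] {f : E → F} {p : E}
    (hf : ContDiffAt ℝ ∞ f p) : DifferentiableAt ℝ f p :=
  hf.differentiableAt (by simp)

theorem _root_.ContDiffAt.two_of_infty {E F : Type*} [NormedAddCommGroup E]
    [NormedSpace ℝ E] [NormedAddCommGroup F] [NormedSpace ℝ F] {f : E → F} {p : E}
    (hf : ContDiffAt ℝ ∞ f p) : ContDiffAt ℝ 2 f p :=
  mod_cast contDiffAt_infty.mp hf 2

theorem _root_.ContDiffAt.eventually_two {E F : Type*} [NormedAddCommGroup E]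
    [NormedSpace ℝ E] [NormedAddCommGroup F] [NormedSpace ℝ F] {f : E → F} {p : E}
    (hf : ContDiffAt ℝ 2 f p) : ∀ᶠ y in 𝓝 p, ContDiffAt ℝ 2 f y :=
  hf.eventually (by simp)

theorem pderiv_congr (hfh : f =ᶠ[𝓝 p] h) (i : Fin n) : pderiv i f p = pderiv i h p := by
  simp only [pderiv, hfh.fderiv_eq]

theorem pderiv_eventuallyEq (hfh : f =ᶠ[𝓝 p] h) (i : Fin n) :
    pderiv i f =ᶠ[𝓝 p] pderiv i h := by
  filter_upwards [hfh.eventuallyEq_nhds] with y hy using pderiv_congr hy i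

theorem _root_.ContDiffAt.pderiv {m k : WithTop ℕ∞} (hf : ContDiffAt ℝ m f p) (hk : k + 1 ≤ m)
    (i : Fin n) : ContDiffAt ℝ k (pderiv i f) p :=
  (hf.fderiv_right hk).clm_apply contDiffAt_const

theorem _root_.ContDiffAt.pderiv_infty (hf : ContDiffAt ℝ ∞ f p) (i : Fin n) :
    ContDiffAt ℝ ∞ (RicciDeTurck.pderiv i f) p :=
  hf.pderiv (by simp) i

@[simp] theorem pderiv_const (c : ℝ) (i : Fin n) : pderiv i (fun _ => c) p = 0 := by
  simp [pderiv]

theorem pderiv_add (hf : DifferentiableAt ℝ f p) (hh : DifferentiableAt ℝ h p) (i : Fin n) :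
    pderiv i (fun y => f y + h y) p = pderiv i f p + pderiv i h p := by
  simp only [pderiv]
  rw [fderiv_fun_add hf hh]; rfl

theorem pderiv_sub (hf : DifferentiableAt ℝ f p) (hh : DifferentiableAt ℝ h p) (i : Fin n) :
    pderiv i (fun y => f y - h y) p = pderiv i f p - pderiv i h p := by
  simp only [pderiv]
  rw [fderiv_fun_sub hf hh]; rfl

theorem pderiv_mul (hf : DifferentiableAt ℝ f p) (hh : DifferentiableAt ℝ h p) (i : Fin n) :
    pderiv i (fun y => f y * h y) p = pderiv i f p * h p + f p * pderiv i h p := by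
  simp only [pderiv]
  rw [fderiv_fun_mul hf hh]
  simp; ring

theorem pderiv_const_mul (c : ℝ) (hf : DifferentiableAt ℝ f p) (i : Fin n) :
    pderiv i (fun y => c * f y) p = c * pderiv i f p := by
  simp only [pderiv]
  rw [fderiv_const_mul hf]; rfl

theorem pderiv_sum {ι : Type*} (s : Finset ι) {F : ι → EuclideanSpace ℝ (Fin n) → ℝ}
    (hF : ∀ a ∈ s, DifferentiableAt ℝ (F a) p) (i : Fin n) :
    pderiv i (fun y => ∑ a ∈ s, F a y) p = ∑ a ∈ s, pderiv i (F a) p := by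
  simp only [pderiv]
  rw [fderiv_fun_sum hF]; simp

theorem pderiv_comm (hf : ContDiffAt ℝ 2 f p) (i j : Fin n) :
    pderiv i (pderiv j f) p = pderiv j (pderiv i f) p := by
  have hsymm : IsSymmSndFDerivAt ℝ f p := hf.isSymmSndFDerivAt (by simp)
  have hd : DifferentiableAt ℝ (fderiv ℝ f) p :=
    (hf.fderiv_right (m := 1) (by norm_num)).differentiableAt (by norm_num)
  have key : ∀ i j : Fin n, pderiv i (pderiv j f) p =
      fderiv ℝ (fderiv ℝ f) p (EuclideanSpace.single i 1) (EuclideanSpace.single j 1) := by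
    intro i j
    unfold pderiv
    rw [fderiv_clm_apply hd (differentiableAt_const _)]
    simp
  rw [key, key]; exact hsymm _ _

/-- The second derivatives of a product. -/
theorem pderiv_pderiv_mul (hf : ContDiffAt ℝ 2 f p) (hh : ContDiffAt ℝ 2 h p) (i j : Fin n) :
    pderiv i (pderiv j (fun y => f y * h y)) p
      = pderiv i (pderiv j f) p * h p + pderiv j f p * pderiv i h p
        + (pderiv i f p * pderiv j h p + f p * pderiv i (pderiv j h) p) := by
  have h1 : pderiv j (fun y => f y * h y) =ᶠ[𝓝 p]
      fun y => pderiv j f y * h y + f y * pderiv j h y := by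
    filter_upwards [hf.eventually_two, hh.eventually_two] with y hy1 hy2
    exact pderiv_mul (hy1.differentiableAt (by simp)) (hy2.differentiableAt (by simp)) j
  have df := hf.differentiableAt (by simp)
  have dh := hh.differentiableAt (by simp)
  have df' := (hf.pderiv (k := 1) (by norm_num) j).differentiableAt (by simp)
  have dh' := (hh.pderiv (k := 1) (by norm_num) j).differentiableAt (by simp)
  rw [pderiv_congr h1, pderiv_add (df'.fun_mul dh) (df.fun_mul dh'), pderiv_mul df' dh,
    pderiv_mul df dh']

theorem pderiv_pderiv_sum {ι : Type*} (s : Finset ι) {F : ι → EuclideanSpace ℝ (Fin n) → ℝ}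
    (hF : ∀ a ∈ s, ContDiffAt ℝ 2 (F a) p) (i j : Fin n) :
    pderiv i (pderiv j (fun y => ∑ a ∈ s, F a y)) p = ∑ a ∈ s, pderiv i (pderiv j (F a)) p := by
  have h1 : pderiv j (fun y => ∑ a ∈ s, F a y) =ᶠ[𝓝 p] fun y => ∑ a ∈ s, pderiv j (F a) y := by
    have : ∀ᶠ y in 𝓝 p, ∀ a ∈ s, ContDiffAt ℝ 2 (F a) y :=
      (Finset.eventually_all s).2 fun a ha => (hF a ha).eventually_two
    filter_upwards [this] with y hy
    exact pderiv_sum s (fun a ha => (hy a ha).differentiableAt (by simp)) j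
  rw [pderiv_congr h1, pderiv_sum]
  exact fun a ha => ((hF a ha).pderiv (k := 1) (by norm_num) j).differentiableAt (by simp)

theorem fderiv_apply_eq_sum_pderiv (v : EuclideanSpace ℝ (Fin n)) :
    fderiv ℝ f p v = ∑ i, v i * pderiv i f p := by
  have hv : v = ∑ i, v i • EuclideanSpace.single i (1 : ℝ) := by
    ext j
    simp [Finset.sum_apply, Pi.single_apply]
  conv_lhs => rw [hv]
  simp [pderiv]

theorem pderiv_component {m : ℕ} {p : EuclideanSpace ℝ (Fin m)}
    {φ : EuclideanSpace ℝ (Fin m) → EuclideanSpace ℝ (Fin n)} (hφ : DifferentiableAt ℝ φ p)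
    (a : Fin n) (i : Fin m) :
    pderiv i (fun y => φ y a) p = fderiv ℝ φ p (EuclideanSpace.single i 1) a := by
  have := ((EuclideanSpace.proj a : EuclideanSpace ℝ (Fin n) →L[ℝ] ℝ).hasFDerivAt.comp p
    hφ.hasFDerivAt).fderiv
  exact congrArg (fun L => L (EuclideanSpace.single i 1)) this

/-- The chain rule, for a map `φ` given by its components. -/
theorem pderiv_comp {m : ℕ} {p : EuclideanSpace ℝ (Fin m)}
    {φ : EuclideanSpace ℝ (Fin m) → EuclideanSpace ℝ (Fin n)}
    (hf : DifferentiableAt ℝ f (φ p)) (hφ : DifferentiableAt ℝ φ p) (i : Fin m) :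
    pderiv i (fun y => f (φ y)) p = ∑ a, pderiv i (fun y => φ y a) p * pderiv a f (φ p) := by
  simp only [pderiv_component hφ]
  rw [← fderiv_apply_eq_sum_pderiv]
  unfold pderiv
  rw [show (fun y => f (φ y)) = f ∘ φ from rfl, fderiv_comp p hf hφ]
  rfl

end PartialDerivatives

/-! ### Metrics in coordinates -/

section CoordinateMetrics

open Filter Topology

variable {n : ℕ} {p : EuclideanSpace ℝ (Fin n)}
  {G G' : EuclideanSpace ℝ (Fin n) → Matrix (Fin n) (Fin n) ℝ}

/-- The matrix-valued function `G` is a smooth Riemannian metric near the point `p`. -/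
structure IsMetricNear (G : EuclideanSpace ℝ (Fin n) → Matrix (Fin n) (Fin n) ℝ)
    (p : EuclideanSpace ℝ (Fin n)) : Prop where
  smooth (i j : Fin n) : ContDiffAt ℝ ∞ (fun y => G y i j) p
  posDef : ∀ᶠ y in 𝓝 p, (G y).PosDef

theorem contDiffAt_det {A : EuclideanSpace ℝ (Fin n) → Matrix (Fin n) (Fin n) ℝ}
    (hA : ∀ i j, ContDiffAt ℝ ∞ (fun y => A y i j) p) :
    ContDiffAt ℝ ∞ (fun y => (A y).det) p := by
  simp only [Matrix.det_apply']
  refine ContDiffAt.sum fun σ _ => contDiffAt_const.mul (contDiffAt_prod fun i _ => hA _ _)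

theorem contDiffAt_matrix_inv {A : EuclideanSpace ℝ (Fin n) → Matrix (Fin n) (Fin n) ℝ}
    (hA : ∀ i j, ContDiffAt ℝ ∞ (fun y => A y i j) p) (h0 : (A p).det ≠ 0) (i j : Fin n) :
    ContDiffAt ℝ ∞ (fun y => (A y)⁻¹ i j) p := by
  simp only [Matrix.inv_def, Ring.inverse_eq_inv', Matrix.smul_apply, smul_eq_mul,
    Matrix.adjugate_apply]
  refine ((contDiffAt_det hA).inv h0).mul (contDiffAt_det fun a b => ?_)
  by_cases ha : a = j
  · subst ha; simpa using contDiffAt_const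
  · simpa [Matrix.updateRow_ne ha] using hA a b

namespace IsMetricNear

theorem posDef_self (hG : IsMetricNear G p) : (G p).PosDef := hG.posDef.self_of_nhds

theorem det_ne_zero (hG : IsMetricNear G p) : (G p).det ≠ 0 := hG.posDef_self.det_pos.ne'

theorem symm_eventually (hG : IsMetricNear G p) (i j : Fin n) :
    (fun y => G y i j) =ᶠ[𝓝 p] fun y => G y j i := by
  filter_upwards [hG.posDef] with y hy
  simpa using (hy.isHermitian.apply i j).symm

theorem inv_smooth (hG : IsMetricNear G p) (i j : Fin n) :
    ContDiffAt ℝ ∞ (fun y => (G y)⁻¹ i j) p :=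
  contDiffAt_matrix_inv hG.smooth hG.det_ne_zero i j

end IsMetricNear

/-- Twice the Christoffel symbols of the first kind, `∂ᵢ gⱼₗ + ∂ⱼ gᵢₗ - ∂ₗ gᵢⱼ`. -/
def christoffelFirst (G : EuclideanSpace ℝ (Fin n) → Matrix (Fin n) (Fin n) ℝ)
    (l i j : Fin n) (y : EuclideanSpace ℝ (Fin n)) : ℝ :=
  pderiv i (fun z => G z j l) y + pderiv j (fun z => G z i l) y - pderiv l (fun z => G z i j) y

theorem christoffel_eq (k i j : Fin n) :
    christoffel G k i j = fun y => (1 / 2 : ℝ) * ∑ l, (G y)⁻¹ k l * christoffelFirst G l i j y :=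
  rfl

namespace IsMetricNear

theorem christoffelFirst_smooth (hG : IsMetricNear G p) (l i j : Fin n) :
    ContDiffAt ℝ ∞ (christoffelFirst G l i j) p :=
  (((hG.smooth j l).pderiv_infty i).add ((hG.smooth i l).pderiv_infty j)).sub
    ((hG.smooth i j).pderiv_infty l)

theorem christoffel_smooth (hG : IsMetricNear G p) (k i j : Fin n) :
    ContDiffAt ℝ ∞ (christoffel G k i j) p := by
  rw [christoffel_eq]
  exact contDiffAt_const.mul
    (ContDiffAt.sum fun l _ => (hG.inv_smooth k l).mul (hG.christoffelFirst_smooth l i j))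

theorem deTurckVector_smooth (hG : IsMetricNear G p) (hG' : IsMetricNear G' p) (k : Fin n) :
    ContDiffAt ℝ ∞ (deTurckVector G G' k) p :=
  ContDiffAt.sum fun a _ => ContDiffAt.sum fun b _ =>
    (hG.inv_smooth a b).mul ((hG.christoffel_smooth k a b).sub (hG'.christoffel_smooth k a b))

end IsMetricNear

/-- The coordinates are normal for the metric `G` at `p`, to first order. -/
structure IsNormalAt (G : EuclideanSpace ℝ (Fin n) → Matrix (Fin n) (Fin n) ℝ)
    (p : EuclideanSpace ℝ (Fin n)) : Prop where
  eq_one : G p = 1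
  pderiv_eq_zero (k i j : Fin n) : pderiv k (fun y => G y i j) p = 0

namespace IsNormalAt

theorem inv_eq_one (hN : IsNormalAt G p) : (G p)⁻¹ = 1 := by rw [hN.eq_one, inv_one]

theorem pderiv_inv (hN : IsNormalAt G p) (hG : IsMetricNear G p) (k i j : Fin n) :
    pderiv k (fun y => (G y)⁻¹ i j) p = 0 := by
  have h1 : (fun y => ∑ l, (G y)⁻¹ i l * G y l j) =ᶠ[𝓝 p]
      fun _ => (1 : Matrix (Fin n) (Fin n) ℝ) i j := by
    filter_upwards [hG.posDef] with y hy
    rw [← Matrix.mul_apply, Matrix.nonsing_inv_mul _ (isUnit_iff_ne_zero.2 hy.det_pos.ne')]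
  have h2 := pderiv_congr h1 k
  rw [pderiv_const, pderiv_sum _ fun l _ => (hG.inv_smooth i l).differentiableAt_infty.fun_mul
    (hG.smooth l j).differentiableAt_infty] at h2
  simp only [pderiv_mul (hG.inv_smooth i _).differentiableAt_infty
    (hG.smooth _ j).differentiableAt_infty, hN.pderiv_eq_zero, hN.eq_one, Matrix.one_apply,
    mul_zero, add_zero, mul_ite, mul_one] at h2
  simpa using h2

theorem christoffelFirst_eq_zero (hN : IsNormalAt G p) (l i j : Fin n) :
    christoffelFirst G l i j p = 0 := by
  simp [christoffelFirst, hN.pderiv_eq_zero]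

theorem christoffel_eq_zero (hN : IsNormalAt G p) (k i j : Fin n) :
    christoffel G k i j p = 0 := by
  simp [christoffel_eq, hN.christoffelFirst_eq_zero]

theorem pderiv_christoffel (hN : IsNormalAt G p) (hG : IsMetricNear G p) (a k i j : Fin n) :
    pderiv a (christoffel G k i j) p = 1 / 2 * pderiv a (christoffelFirst G k i j) p := by
  have hd l := (hG.inv_smooth k l).differentiableAt_infty
  have hc l := (hG.christoffelFirst_smooth l i j).differentiableAt_infty
  rw [christoffel_eq,
    pderiv_const_mul _ (DifferentiableAt.fun_sum fun l _ => (hd l).fun_mul (hc l)),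
    pderiv_sum _ fun l _ => (hd l).fun_mul (hc l)]
  congr 1
  simp [pderiv_mul (hd _) (hc _), hN.christoffelFirst_eq_zero, hN.inv_eq_one, Matrix.one_apply]

theorem pderiv_pderiv_christoffel (hN : IsNormalAt G p) (hG : IsMetricNear G p)
    (a b k i j : Fin n) :
    pderiv a (pderiv b (christoffel G k i j)) p
      = 1 / 2 * pderiv a (pderiv b (christoffelFirst G k i j)) p := by
  have hd l := (hG.inv_smooth k l).two_of_infty
  have hc l := (hG.christoffelFirst_smooth l i j).two_of_infty
  rw [christoffel_eq, pderiv_pderiv_mul contDiffAt_const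
    (ContDiffAt.sum fun l _ => (hd l).mul (hc l)),
    pderiv_pderiv_sum _ fun l _ => (hd l).mul (hc l)]
  simp [pderiv_pderiv_mul (hd _) (hc _), hN.christoffelFirst_eq_zero, hN.inv_eq_one,
    hN.pderiv_inv hG, Matrix.one_apply]

end IsNormalAt

theorem IsMetricNear.pderiv_christoffelFirst (hG : IsMetricNear G p) (a l i j : Fin n) :
    pderiv a (christoffelFirst G l i j) p
      = pderiv a (pderiv i (fun y => G y j l)) p + pderiv a (pderiv j (fun y => G y i l)) p
        - pderiv a (pderiv l (fun y => G y i j)) p := by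
  have hd i j k := ((hG.smooth i j).pderiv_infty k).differentiableAt_infty
  unfold christoffelFirst
  rw [pderiv_sub ((hd _ _ _).fun_add (hd _ _ _)) (hd _ _ _), pderiv_add (hd _ _ _) (hd _ _ _)]

theorem IsMetricNear.pderiv_pderiv_christoffelFirst (hG : IsMetricNear G p) (a b l i j : Fin n) :
    pderiv a (pderiv b (christoffelFirst G l i j)) p
      = pderiv a (pderiv b (pderiv i (fun y => G y j l))) p
        + pderiv a (pderiv b (pderiv j (fun y => G y i l))) p
        - pderiv a (pderiv b (pderiv l (fun y => G y i j))) p := by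
  have hev : pderiv b (christoffelFirst G l i j) =ᶠ[𝓝 p] fun y =>
      pderiv b (pderiv i (fun y => G y j l)) y + pderiv b (pderiv j (fun y => G y i l)) y
        - pderiv b (pderiv l (fun y => G y i j)) y := by
    have hd i j k : ∀ᶠ y in 𝓝 p, DifferentiableAt ℝ (pderiv k (fun y => G y i j)) y := by
      have h2 : ContDiffAt ℝ 2 (pderiv k (fun y => G y i j)) p :=
        ((hG.smooth i j).pderiv_infty k).two_of_infty
      filter_upwards [h2.eventually_two] with y hy using hy.differentiableAt (by simp)
    filter_upwards [hd j l i, hd i l j, hd i j l] with y h1 h2 h3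
    unfold christoffelFirst
    rw [pderiv_sub (h1.fun_add h2) h3, pderiv_add h1 h2]
  have hd i j k m := (((hG.smooth i j).pderiv_infty k).pderiv_infty m).differentiableAt_infty
  rw [pderiv_congr hev, pderiv_sub ((hd _ _ _ _).fun_add (hd _ _ _ _)) (hd _ _ _ _),
    pderiv_add (hd _ _ _ _) (hd _ _ _ _)]

end CoordinateMetrics

/-! ### Stationary metrics in normal coordinates -/

section NormalCoordinates

open Filter Topology Matrix

variable {n : ℕ} {p : EuclideanSpace ℝ (Fin n)}
  {G G' : EuclideanSpace ℝ (Fin n) → Matrix (Fin n) (Fin n) ℝ}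
  {W : Fin n → EuclideanSpace ℝ (Fin n) → ℝ}

namespace IsNormalAt

theorem ricci_eq (hN : IsNormalAt G p) (hG : IsMetricNear G p) (i j : Fin n) :
    ricci G i j p = ∑ k, (1 / 2 : ℝ) *
      (pderiv k (christoffelFirst G k i j) p - pderiv i (christoffelFirst G k k j) p) := by
  simp [ricci, hN.christoffel_eq_zero, hN.pderiv_christoffel hG, mul_sub]

theorem pderiv_ricci (hN : IsNormalAt G p) (hG : IsMetricNear G p) (a i j : Fin n) :
    pderiv a (ricci G i j) p = ∑ k, (1 / 2 : ℝ) *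
      (pderiv a (pderiv k (christoffelFirst G k i j)) p
        - pderiv a (pderiv i (christoffelFirst G k k j)) p) := by
  have hd k i j := (hG.christoffel_smooth k i j).differentiableAt_infty
  have hd' k i j l := ((hG.christoffel_smooth k i j).pderiv_infty l).differentiableAt_infty
  have h1 k : DifferentiableAt ℝ (fun y => pderiv k (christoffel G k i j) y
      - pderiv i (christoffel G k k j) y) p := (hd' _ _ _ _).fun_sub (hd' _ _ _ _)
  have h2 k l : DifferentiableAt ℝ (fun y => christoffel G k k l y * christoffel G l i j y
      - christoffel G k i l y * christoffel G l k j y) p :=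
    ((hd _ _ _).fun_mul (hd _ _ _)).fun_sub ((hd _ _ _).fun_mul (hd _ _ _))
  unfold ricci
  rw [pderiv_add (DifferentiableAt.fun_sum fun k _ => h1 k)
      (DifferentiableAt.fun_sum fun k _ => DifferentiableAt.fun_sum fun l _ => h2 k l),
    pderiv_sum _ fun k _ => h1 k,
    pderiv_sum _ fun k _ => DifferentiableAt.fun_sum fun l _ => h2 k l]
  simp only [pderiv_sum _ fun l _ => h2 _ l]
  simp [pderiv_sub (hd' _ _ _ _) (hd' _ _ _ _),
    pderiv_sub ((hd _ _ _).fun_mul (hd _ _ _)) ((hd _ _ _).fun_mul (hd _ _ _)),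
    pderiv_mul (hd _ _ _) (hd _ _ _), hN.christoffel_eq_zero,
    hN.pderiv_pderiv_christoffel hG, mul_sub]

theorem lieDerivMetric_eq (hN : IsNormalAt G p) (i j : Fin n) :
    lieDerivMetric W G i j p = pderiv i (W j) p + pderiv j (W i) p := by
  simp [lieDerivMetric, hN.pderiv_eq_zero, hN.eq_one, Matrix.one_apply, Finset.sum_add_distrib]

theorem pderiv_lieDerivMetric (hN : IsNormalAt G p) (hG : IsMetricNear G p)
    (hW : ∀ k, ContDiffAt ℝ ∞ (W k) p) (a i j : Fin n) :
    pderiv a (lieDerivMetric W G i j) p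
      = ∑ k, W k p * pderiv a (pderiv k (fun y => G y i j)) p
        + pderiv a (pderiv i (W j)) p + pderiv a (pderiv j (W i)) p := by
  have hg i j := (hG.smooth i j).differentiableAt_infty
  have hg' i j k := ((hG.smooth i j).pderiv_infty k).differentiableAt_infty
  have hw k := (hW k).differentiableAt_infty
  have hw' k i := ((hW k).pderiv_infty i).differentiableAt_infty
  unfold lieDerivMetric
  rw [pderiv_sum _ fun k _ => (((hw k).fun_mul (hg' i j k)).fun_add
    ((hg k j).fun_mul (hw' k i))).fun_add ((hg i k).fun_mul (hw' k j))]
  simp [pderiv_add (((hw _).fun_mul (hg' i j _)).fun_add ((hg _ j).fun_mul (hw' _ i)))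
      ((hg i _).fun_mul (hw' _ j)),
    pderiv_add ((hw _).fun_mul (hg' i j _)) ((hg _ j).fun_mul (hw' _ i)),
    pderiv_mul (hw _) (hg' i j _), pderiv_mul (hg _ j) (hw' _ i), pderiv_mul (hg i _) (hw' _ j),
    hN.pderiv_eq_zero, hN.eq_one, Matrix.one_apply, Finset.sum_add_distrib]

end IsNormalAt

theorem sum_sum_sub_swap {ι : Type*} [Fintype ι] (f : ι → ι → ℝ) :
    ∑ i, ∑ k, (f i k - f k i) = 0 := by
  simp only [Finset.sum_sub_distrib]
  rw [Finset.sum_comm, sub_self]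

/-- The contracted second Bianchi identity `∑ᵢ ∂ᵢ Rᵢⱼ = ½ ∑ᵢ ∂ⱼ Rᵢᵢ` at the centre of normal
coordinates. -/
theorem IsNormalAt.contracted_bianchi (hN : IsNormalAt G p) (hG : IsMetricNear G p) (j : Fin n) :
    ∑ i, pderiv i (ricci G i j) p = 1 / 2 * ∑ i, pderiv j (ricci G i i) p := by
  have hc a b i j k : pderiv a (pderiv b (pderiv i (fun y => G y j k))) p
      = pderiv b (pderiv a (pderiv i (fun y => G y j k))) p :=
    pderiv_comm ((hG.smooth j k).pderiv_infty i).two_of_infty a b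
  have hc' a b i j k : pderiv a (pderiv b (pderiv i (fun y => G y j k))) p
      = pderiv a (pderiv i (pderiv b (fun y => G y j k))) p := by
    refine pderiv_congr ?_ a
    filter_upwards [(hG.smooth j k).two_of_infty.eventually_two] with y hy using pderiv_comm hy b i
  have hs a b i j k : pderiv a (pderiv b (pderiv i (fun y => G y j k))) p
      = pderiv a (pderiv b (pderiv i (fun y => G y k j))) p :=
    pderiv_congr (pderiv_eventuallyEq (pderiv_eventuallyEq (hG.symm_eventually j k) i) b) a
  simp only [hN.pderiv_ricci hG, hG.pderiv_pderiv_christoffelFirst]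
  set T := fun a b c i j => pderiv a (pderiv b (pderiv c (fun y => G y i j))) p with hT
  have h1 : ∑ i, ∑ k, (T i k k j i - T k i i j k) = 0 := sum_sum_sub_swap fun i k => T i k k j i
  have h2 : ∑ i, ∑ k, (T j k k i i - T j i i k k) = 0 := sum_sum_sub_swap fun i k => T j k k i i
  -- Up to symmetries of the third derivatives, the difference of the two sides is antisymmetric in
  -- the summation indices.
  rw [← sub_eq_zero]
  trans ∑ i, ∑ k, ((-1 / 2) * (T i k k j i - T k i i j k) + (1 / 4) * (T j k k i i - T j i i k k))
  · simp only [Finset.mul_sum, ← Finset.sum_sub_distrib]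
    refine Finset.sum_congr rfl fun i _ => Finset.sum_congr rfl fun k _ => ?_
    have e1 : T i k i j k = T i i k j k := hc' _ _ _ _ _
    have e2 : T i k j i k = T j i k i k := by simp only [hT]; rw [hc' i k j, hc i j k]
    have e3 : T i k k i j = T i k k j i := hs _ _ _ _ _
    have e4 : T i i k k j = T i i k j k := hs _ _ _ _ _
    have e5 : T j k i i k = T j i k i k := hc' _ _ _ _ _
    have e6 : T i i j k k = T j i i k k := by simp only [hT]; rw [hc' i i j, hc i j i]
    have e7 : T j i k k i = T j i k i k := hs _ _ _ _ _
    have e8 : T k i i j k = T i i k j k := by simp only [hT]; rw [hc k i i, hc' i k i]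
    simp only [hT] at e1 e2 e3 e4 e5 e6 e7 e8 ⊢
    linarith
  · simp only [Finset.sum_add_distrib, ← Finset.mul_sum, h1, h2]; simp

/-- The divergence of the equation `Ric + L_W g = 0`, minus half the differential of its trace. In
invariant terms it reads `Δ W + Ric(W) = 0`; the second derivatives of the metric come both from the
curvature term and from `Δ W`. -/
theorem IsNormalAt.laplacian_vector (hN : IsNormalAt G p) (hG : IsMetricNear G p)
    (hW : ∀ k, ContDiffAt ℝ ∞ (W k) p)
    (hE : ∀ᶠ y in 𝓝 p, ∀ i j, ricci G i j y + lieDerivMetric W G i j y = 0) (j : Fin n) :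
    ∑ i, pderiv i (pderiv i (W j)) p
      + ∑ k, W k p * ∑ i, (pderiv i (pderiv k (fun y => G y i j)) p
        - 1 / 2 * pderiv j (pderiv k (fun y => G y i i)) p) = 0 := by
  have hE' a i j : pderiv a (ricci G i j) p + pderiv a (lieDerivMetric W G i j) p = 0 := by
    have h1 : (ricci G i j) =ᶠ[𝓝 p] fun y => (-1) * lieDerivMetric W G i j y := by
      filter_upwards [hE] with y hy
      linarith [hy i j]
    rw [pderiv_congr h1, pderiv_const_mul]
    · ring
    · have hg i j := (hG.smooth i j).differentiableAt_infty
      have hg' i j k := ((hG.smooth i j).pderiv_infty k).differentiableAt_infty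
      have hw k := (hW k).differentiableAt_infty
      have hw' k i := ((hW k).pderiv_infty i).differentiableAt_infty
      exact DifferentiableAt.fun_sum fun k _ => (((hw k).fun_mul (hg' i j k)).fun_add
        ((hg k j).fun_mul (hw' k i))).fun_add ((hg i k).fun_mul (hw' k j))
  have hB := hN.contracted_bianchi hG j
  have e1 : ∑ i, pderiv i (ricci G i j) p = - ∑ i, pderiv i (lieDerivMetric W G i j) p := by
    rw [← Finset.sum_neg_distrib]
    exact Finset.sum_congr rfl fun i _ => by linarith [hE' i i j]
  have e2 : ∑ i, pderiv j (ricci G i i) p = - ∑ i, pderiv j (lieDerivMetric W G i i) p := by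
    rw [← Finset.sum_neg_distrib]
    exact Finset.sum_congr rfl fun i _ => by linarith [hE' j i i]
  rw [e1, e2] at hB
  simp only [hN.pderiv_lieDerivMetric hG hW, Finset.sum_add_distrib] at hB
  have e3 : ∑ i, pderiv i (pderiv j (W i)) p = ∑ i, pderiv j (pderiv i (W i)) p :=
    Finset.sum_congr rfl fun i _ => pderiv_comm (hW i).two_of_infty i j
  have e4 : ∑ k, W k p * ∑ i, (pderiv i (pderiv k (fun y => G y i j)) p
        - 1 / 2 * pderiv j (pderiv k (fun y => G y i i)) p)
      = ∑ i, ∑ k, W k p * pderiv i (pderiv k (fun y => G y i j)) p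
        - 1 / 2 * ∑ i, ∑ k, W k p * pderiv j (pderiv k (fun y => G y i i)) p := by
    rw [Finset.mul_sum, ← Finset.sum_sub_distrib]
    simp only [Finset.mul_sum, ← Finset.sum_sub_distrib]
    rw [Finset.sum_comm]
    exact Finset.sum_congr rfl fun i _ => Finset.sum_congr rfl fun k _ => by ring
  rw [e4]
  rw [e3] at hB
  linarith

/-- The function `|W|²`, the squared length of the vector field `W` in the metric `G`. -/
def normSqField (G : EuclideanSpace ℝ (Fin n) → Matrix (Fin n) (Fin n) ℝ)
    (W : Fin n → EuclideanSpace ℝ (Fin n) → ℝ) (y : EuclideanSpace ℝ (Fin n)) : ℝ :=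
  ∑ i, ∑ j, G y i j * (W i y * W j y)

theorem normSqField_eq_dotProduct (y : EuclideanSpace ℝ (Fin n)) :
    normSqField G W y = (fun k => W k y) ⬝ᵥ (G y *ᵥ fun k => W k y) := by
  simp only [normSqField, dotProduct, Matrix.mulVec, Finset.mul_sum]
  exact Finset.sum_congr rfl fun a _ => Finset.sum_congr rfl fun b _ => by ring

theorem IsNormalAt.pderiv_normSqField (hN : IsNormalAt G p) (hG : IsMetricNear G p)
    (hW : ∀ k, ContDiffAt ℝ ∞ (W k) p) (k : Fin n) :
    pderiv k (normSqField G W) p = 2 * ∑ i, W i p * pderiv k (W i) p := by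
  have hg i j := (hG.smooth i j).differentiableAt_infty
  have hw k := (hW k).differentiableAt_infty
  unfold normSqField
  rw [pderiv_sum _ fun i _ => DifferentiableAt.fun_sum fun j _ =>
    (hg i j).fun_mul ((hw i).fun_mul (hw j)), Finset.mul_sum]
  refine Finset.sum_congr rfl fun i _ => ?_
  rw [pderiv_sum _ fun j _ => (hg i j).fun_mul ((hw i).fun_mul (hw j))]
  simp only [pderiv_mul (hg i _) ((hw i).fun_mul (hw _)), pderiv_mul (hw i) (hw _),
    hN.pderiv_eq_zero, hN.eq_one, Matrix.one_apply]
  simp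
  ring

theorem IsNormalAt.pderiv_pderiv_normSqField (hN : IsNormalAt G p) (hG : IsMetricNear G p)
    (hW : ∀ k, ContDiffAt ℝ ∞ (W k) p) (a : Fin n) :
    pderiv a (pderiv a (normSqField G W)) p
      = ∑ i, ∑ j, pderiv a (pderiv a (fun y => G y i j)) p * (W i p * W j p)
        + 2 * ∑ i, W i p * pderiv a (pderiv a (W i)) p + 2 * ∑ i, (pderiv a (W i) p) ^ 2 := by
  have hg i j := (hG.smooth i j).two_of_infty
  have hw k := (hW k).two_of_infty
  unfold normSqField
  rw [pderiv_pderiv_sum _ fun i _ => ContDiffAt.sum fun j _ => (hg i j).mul ((hw i).mul (hw j)),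
    Finset.mul_sum, Finset.mul_sum, ← Finset.sum_add_distrib, ← Finset.sum_add_distrib]
  refine Finset.sum_congr rfl fun i _ => ?_
  rw [pderiv_pderiv_sum _ fun j _ => (hg i j).mul ((hw i).mul (hw j))]
  simp only [pderiv_pderiv_mul (hg i _) ((hw i).mul (hw _)), pderiv_pderiv_mul (hw i) (hw _),
    hN.pderiv_eq_zero, hN.eq_one, Matrix.one_apply, Finset.sum_add_distrib]
  simp
  ring

/-- The Bochner formula for a solution of `Ric + L_W g = 0`, in normal coordinates:
`Δ|W|² - 2 W(|W|²) = 2 |∇W|²`. -/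
theorem IsNormalAt.bochner (hN : IsNormalAt G p) (hG : IsMetricNear G p)
    (hW : ∀ k, ContDiffAt ℝ ∞ (W k) p)
    (hE : ∀ᶠ y in 𝓝 p, ∀ i j, ricci G i j y + lieDerivMetric W G i j y = 0) :
    ∑ a, pderiv a (pderiv a (normSqField G W)) p - 2 * ∑ k, W k p * pderiv k (normSqField G W) p
      = 2 * ∑ a, ∑ i, (pderiv a (W i) p) ^ 2 := by
  have hs a b i j : pderiv a (pderiv b (fun y => G y i j)) p
      = pderiv a (pderiv b (fun y => G y j i)) p :=
    pderiv_congr (pderiv_eventuallyEq (hG.symm_eventually i j) b) a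
  have hc a b i j : pderiv a (pderiv b (fun y => G y i j)) p
      = pderiv b (pderiv a (fun y => G y i j)) p := pderiv_comm (hG.smooth i j).two_of_infty a b
  have hL j := hN.laplacian_vector hG hW hE j
  have hR i j := hE.self_of_nhds i j
  simp only [hN.ricci_eq hG, hN.lieDerivMetric_eq, hG.pderiv_christoffelFirst] at hR
  simp only [hN.pderiv_normSqField hG hW, hN.pderiv_pderiv_normSqField hG hW]
  set S := fun a b i j => pderiv a (pderiv b (fun y => G y i j)) p with hS
  set D := fun a i => pderiv a (W i) p with hD
  set D2 := fun i => ∑ a, pderiv a (pderiv a (W i)) p with hD2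
  set w := fun i => W i p with hw
  have hR' : ∀ i j, ∑ k, (S k i j k + S k j i k - S k k i j - S i j k k)
      = -2 * (D i j + D j i) := by
    intro i j
    have := hR i j
    rw [Finset.sum_congr rfl (g := fun k => 1 / 2 * (S k i j k + S k j i k - S k k i j - S i j k k))
      (fun k _ => by
        have : S i k k j = S i k j k := hs _ _ _ _
        simp only [hS] at this ⊢
        linarith), ← Finset.mul_sum] at this
    simp only [hD]
    linarith
  -- Evaluate the stationarity equation on the pair `(W, W)`.
  have h1 : ∑ i, ∑ j, w i * w j * ∑ k, (S k i j k + S k j i k - S k k i j - S i j k k)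
      = -4 * ∑ i, ∑ j, w i * w j * D i j := by
    simp only [hR']
    have : ∑ i, ∑ j, (w i * w j * D i j - w j * w i * D j i) = 0 :=
      sum_sum_sub_swap fun i j => w i * w j * D i j
    trans ∑ i, ∑ j, (-4 * (w i * w j * D i j) + 2 * (w i * w j * D i j - w j * w i * D j i))
    · exact Finset.sum_congr rfl fun i _ => Finset.sum_congr rfl fun j _ => by ring
    · simp only [Finset.sum_add_distrib, ← Finset.mul_sum, this]; simp
  -- Contract the equation `Δ W + Ric(W) = 0` with `W`.
  have h2 : ∑ j, w j * D2 j = - ∑ j, ∑ k, w j * w k * ∑ i, (S i k i j - 1 / 2 * S j k i i) := by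
    rw [← Finset.sum_neg_distrib]
    refine Finset.sum_congr rfl fun j _ => ?_
    have := congrArg (fun x => w j * x) (hL j)
    simp only [mul_zero, mul_add, Finset.mul_sum] at this
    simp only [hD2, Finset.mul_sum, hw, hS, mul_assoc] at this ⊢
    linarith
  have h3 : ∑ a, ∑ i, w i * pderiv a (pderiv a (W i)) p = ∑ i, w i * D2 i := by
    rw [Finset.sum_comm]; simp only [hD2, Finset.mul_sum]
  have h4 : ∑ k, w k * (2 * ∑ i, w i * D k i) = 2 * ∑ i, ∑ j, w i * w j * D i j := by
    simp only [Finset.mul_sum]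
    exact Finset.sum_congr rfl fun i _ => Finset.sum_congr rfl fun j _ => by ring
  have h5 : ∑ a, ∑ i, ∑ j, S a a i j * (w i * w j)
      = ∑ i, ∑ j, w i * w j * ∑ a, S a a i j := by
    rw [Finset.sum_comm]
    refine Finset.sum_congr rfl fun i _ => ?_
    rw [Finset.sum_comm]
    exact Finset.sum_congr rfl fun j _ => by
      rw [Finset.mul_sum]; exact Finset.sum_congr rfl fun a _ => by ring
  -- The second derivatives of the metric in `Ric(W, W)` split into those of `h2` and those that
  -- come from differentiating `|W|²` twice.
  have h6 : ∑ i, ∑ j, w i * w j * ∑ k, (S k i j k + S k j i k - S k k i j - S i j k k)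
      = 2 * (∑ j, ∑ k, w j * w k * ∑ i, (S i k i j - 1 / 2 * S j k i i))
        - ∑ i, ∑ j, w i * w j * ∑ a, S a a i j := by
    have : ∑ i, ∑ j, (w i * w j * (∑ k, S k j i k) - w j * w i * (∑ k, S k i j k)) = 0 :=
      sum_sum_sub_swap fun i j => w i * w j * ∑ k, S k j i k
    rw [← add_zero (2 * _ - _), ← neg_zero, ← this, Finset.mul_sum, ← Finset.sum_sub_distrib,
      ← Finset.sum_neg_distrib, ← Finset.sum_add_distrib]
    refine Finset.sum_congr rfl fun i _ => ?_
    rw [Finset.mul_sum, ← Finset.sum_sub_distrib,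
      ← Finset.sum_neg_distrib, ← Finset.sum_add_distrib]
    refine Finset.sum_congr rfl fun j _ => ?_
    simp only [Finset.sum_add_distrib, Finset.sum_sub_distrib, ← Finset.mul_sum]
    have e1 : ∑ k, S k j k i = ∑ k, S k j i k := Finset.sum_congr rfl fun k _ => hs _ _ _ _
    rw [e1]
    ring
  simp only [Finset.sum_add_distrib, ← Finset.mul_sum]
  rw [h3, h2, h4, h5]
  linarith

end NormalCoordinates

/-! ### The stress-energy vector field -/

section StressField

open Filter Topology Matrix

variable {n : ℕ} {p : EuclideanSpace ℝ (Fin n)}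
  {G G' : EuclideanSpace ℝ (Fin n) → Matrix (Fin n) (Fin n) ℝ}
  {W : Fin n → EuclideanSpace ℝ (Fin n) → ℝ}

/-- The vector field `½ tr(G⁻¹ G') W - G⁻¹ G' W`, the contraction of `W` with the stress-energy
tensor `½ tr(G⁻¹ G') G - G'` of the identity map from the metric `G` to the metric `G'`. -/
def stressField (G G' : EuclideanSpace ℝ (Fin n) → Matrix (Fin n) (Fin n) ℝ)
    (W : Fin n → EuclideanSpace ℝ (Fin n) → ℝ) (a : Fin n) (y : EuclideanSpace ℝ (Fin n)) : ℝ :=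
  1 / 2 * ((G y)⁻¹ * G' y).trace * W a y - (((G y)⁻¹ * G' y) *ᵥ fun k => W k y) a

theorem stressField_eq (a : Fin n) :
    stressField G G' W a = fun y => 1 / 2 * (∑ i, ∑ j, (G y)⁻¹ i j * G' y j i) * W a y
      - ∑ k, (∑ j, (G y)⁻¹ a j * G' y j k) * W k y := by
  ext y
  simp [stressField, Matrix.trace, Matrix.mul_apply, Matrix.mulVec, dotProduct]

theorem stressField_smooth (hG : IsMetricNear G p) (hG' : IsMetricNear G' p)
    (hW : ∀ k, ContDiffAt ℝ ∞ (W k) p) (a : Fin n) :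
    ContDiffAt ℝ ∞ (stressField G G' W a) p := by
  rw [stressField_eq]
  refine ContDiffAt.sub (ContDiffAt.mul (contDiffAt_const.mul ?_) (hW a)) ?_
  · exact ContDiffAt.sum fun i _ => ContDiffAt.sum fun j _ =>
      (hG.inv_smooth i j).mul (hG'.smooth j i)
  · exact ContDiffAt.sum fun k _ => (ContDiffAt.sum fun j _ =>
      (hG.inv_smooth a j).mul (hG'.smooth j k)).mul (hW k)

/-- In coordinates that are normal for `G`, lowering the index of the DeTurck vector field with the
metric `G'` gives a first order expression in `G'`. -/
theorem IsNormalAt.sum_metric_mul_deTurckVector (hN : IsNormalAt G p) (hG' : IsMetricNear G' p)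
    (j : Fin n) :
    ∑ k, G' p j k * deTurckVector G G' k p
      = 1 / 2 * ∑ i, pderiv j (fun y => G' y i i) p - ∑ i, pderiv i (fun y => G' y i j) p := by
  have h1 k : deTurckVector G G' k p = -∑ i, christoffel G' k i i p := by
    simp [deTurckVector, hN.inv_eq_one, hN.christoffel_eq_zero, Matrix.one_apply]
  have h2 i : ∑ k, G' p j k * christoffel G' k i i p = 1 / 2 * christoffelFirst G' j i i p := by
    have h3 : G' p *ᵥ ((G' p)⁻¹ *ᵥ fun l => christoffelFirst G' l i i p)
        = fun l => christoffelFirst G' l i i p := by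
      rw [Matrix.mulVec_mulVec, Matrix.mul_nonsing_inv _ (isUnit_iff_ne_zero.2 hG'.det_ne_zero),
        Matrix.one_mulVec]
    have h4 := congrFun h3 j
    simp only [Matrix.mulVec, dotProduct] at h4
    rw [← h4, Finset.mul_sum]
    refine Finset.sum_congr rfl fun k _ => ?_
    rw [christoffel_eq]
    ring
  simp only [h1, mul_neg, Finset.mul_sum, Finset.sum_neg_distrib]
  rw [Finset.sum_comm]
  simp only [h2, christoffelFirst]
  rw [← Finset.sum_neg_distrib, ← Finset.sum_sub_distrib]
  exact Finset.sum_congr rfl fun i _ => by ring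

/-- If the DeTurck vector field is parallel, the divergence of its stress-energy field is its
squared length in the reference metric. -/
theorem IsNormalAt.divergence_stressField (hN : IsNormalAt G p) (hG : IsMetricNear G p)
    (hG' : IsMetricNear G' p) (hW : ∀ i a, pderiv a (deTurckVector G G' i) p = 0) :
    ∑ a, pderiv a (stressField G G' (deTurckVector G G') a) p
      = normSqField G' (deTurckVector G G') p := by
  set W := deTurckVector G G' with hWdef
  have hw k : DifferentiableAt ℝ (W k) p := (hG.deTurckVector_smooth hG' k).differentiableAt_infty
  have hg i j := (hG.inv_smooth i j).differentiableAt_infty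
  have hg' i j := (hG'.smooth i j).differentiableAt_infty
  have ht : DifferentiableAt ℝ (fun y => ∑ i, ∑ j, (G y)⁻¹ i j * G' y j i) p :=
    DifferentiableAt.fun_sum fun i _ => DifferentiableAt.fun_sum fun j _ =>
      (hg i j).fun_mul (hg' j i)
  have hs a k : DifferentiableAt ℝ (fun y => ∑ j, (G y)⁻¹ a j * G' y j k) p :=
    DifferentiableAt.fun_sum fun j _ => (hg a j).fun_mul (hg' j k)
  have ht' a : pderiv a (fun y => ∑ i, ∑ j, (G y)⁻¹ i j * G' y j i) p
      = ∑ i, pderiv a (fun y => G' y i i) p := by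
    rw [pderiv_sum _ fun i _ => DifferentiableAt.fun_sum fun j _ => (hg i j).fun_mul (hg' j i)]
    refine Finset.sum_congr rfl fun i _ => ?_
    rw [pderiv_sum _ fun j _ => (hg i j).fun_mul (hg' j i)]
    simp [pderiv_mul (hg i _) (hg' _ i), hN.pderiv_inv hG, hN.inv_eq_one, Matrix.one_apply]
  have hs' a k : pderiv a (fun y => ∑ j, (G y)⁻¹ a j * G' y j k) p
      = pderiv a (fun y => G' y a k) p := by
    rw [pderiv_sum _ fun j _ => (hg a j).fun_mul (hg' j k)]
    simp [pderiv_mul (hg a _) (hg' _ k), hN.pderiv_inv hG, hN.inv_eq_one, Matrix.one_apply]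
  have h1 a : pderiv a (stressField G G' W a) p
      = 1 / 2 * (∑ i, pderiv a (fun y => G' y i i) p) * W a p
        - ∑ k, pderiv a (fun y => G' y a k) p * W k p := by
    rw [stressField_eq, pderiv_sub ((ht.const_mul _).fun_mul (hw a))
        (DifferentiableAt.fun_sum fun k _ => (hs a k).fun_mul (hw k)),
      pderiv_sum _ fun k _ => (hs a k).fun_mul (hw k), pderiv_mul (ht.const_mul _) (hw a),
      pderiv_const_mul _ ht]
    simp only [pderiv_mul (hs a _) (hw _), ht', hs', hW, mul_zero, add_zero]
  simp only [h1, Finset.sum_sub_distrib]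
  rw [Finset.sum_comm (f := fun a k => pderiv a (fun y => G' y a k) p * W k p),
    ← Finset.sum_sub_distrib]
  unfold normSqField
  refine Finset.sum_congr rfl fun a _ => ?_
  have := hN.sum_metric_mul_deTurckVector hG' a
  rw [← Finset.sum_mul, ← sub_mul, ← this, Finset.sum_mul]
  exact Finset.sum_congr rfl fun k _ => by ring

end StressField

/-! ### Changes of coordinates -/

section ChangeOfCoordinates

open Filter Topology Matrix

variable {n : ℕ} {p : EuclideanSpace ℝ (Fin n)}
  {φ : EuclideanSpace ℝ (Fin n) → EuclideanSpace ℝ (Fin n)}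
  {G H G' H' : EuclideanSpace ℝ (Fin n) → Matrix (Fin n) (Fin n) ℝ}

theorem sum_sum_comm_sum_sum {ι κ : Type*} [Fintype ι] [Fintype κ] (f : ι → ι → κ → κ → ℝ) :
    ∑ i, ∑ j, ∑ a, ∑ b, f i j a b = ∑ a, ∑ b, ∑ i, ∑ j, f i j a b := by
  rw [Finset.sum_congr rfl fun i _ => Finset.sum_comm, Finset.sum_comm]
  refine Finset.sum_congr rfl fun a _ => ?_
  rw [Finset.sum_congr rfl fun i _ => Finset.sum_comm, Finset.sum_comm]

/-- The Jacobian matrix of the map `φ`; the entry `(a, i)` is `∂ᵢ φᵃ`. -/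
def jac (φ : EuclideanSpace ℝ (Fin n) → EuclideanSpace ℝ (Fin n))
    (y : EuclideanSpace ℝ (Fin n)) : Matrix (Fin n) (Fin n) ℝ :=
  Matrix.of fun a i => pderiv i (fun z => φ z a) y

theorem jac_apply (hφ : DifferentiableAt ℝ φ p) (a i : Fin n) :
    jac φ p a i = fderiv ℝ φ p (EuclideanSpace.single i 1) a :=
  pderiv_component hφ a i

/-- Near the point `p`, the metric `G` is the pullback of the metric `H` by the smooth map `φ`. -/
structure IsPullbackNear (φ : EuclideanSpace ℝ (Fin n) → EuclideanSpace ℝ (Fin n))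
    (G H : EuclideanSpace ℝ (Fin n) → Matrix (Fin n) (Fin n) ℝ)
    (p : EuclideanSpace ℝ (Fin n)) : Prop where
  smooth : ContDiffAt ℝ ∞ φ p
  metric : IsMetricNear G p
  metric' : IsMetricNear H (φ p)
  eq : ∀ᶠ y in 𝓝 p, G y = (jac φ y)ᵀ * H (φ y) * jac φ y

theorem contDiffAt_component (hφ : ContDiffAt ℝ ∞ φ p) (a : Fin n) :
    ContDiffAt ℝ ∞ (fun y => φ y a) p :=
  (EuclideanSpace.proj a : EuclideanSpace ℝ (Fin n) →L[ℝ] ℝ).contDiff.contDiffAt.comp p hφ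

theorem contDiffAt_jac (hφ : ContDiffAt ℝ ∞ φ p) (a i : Fin n) :
    ContDiffAt ℝ ∞ (fun y => jac φ y a i) p :=
  (contDiffAt_component hφ a).pderiv_infty i

namespace IsPullbackNear

variable (h : IsPullbackNear φ G H p)
include h

theorem eq_self : G p = (jac φ p)ᵀ * H (φ p) * jac φ p := h.eq.self_of_nhds

theorem det_jac_ne_zero : (jac φ p).det ≠ 0 := by
  have h1 := h.metric.det_ne_zero
  rw [h.eq_self, Matrix.det_mul] at h1
  exact right_ne_zero_of_mul h1

theorem jac_mul_inv_mul : jac φ p * (G p)⁻¹ * (jac φ p)ᵀ = (H (φ p))⁻¹ := by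
  have hJ := isUnit_iff_ne_zero.2 h.det_jac_ne_zero
  have hJt : IsUnit (jac φ p)ᵀ.det := by rwa [Matrix.det_transpose]
  rw [h.eq_self, Matrix.mul_inv_rev, Matrix.mul_inv_rev, ← Matrix.mul_assoc, ← Matrix.mul_assoc,
    Matrix.mul_nonsing_inv _ hJ, Matrix.one_mul, Matrix.mul_assoc, Matrix.nonsing_inv_mul _ hJt,
    Matrix.mul_one]

theorem pderiv_metric (l i j : Fin n) :
    pderiv l (fun y => G y i j) p
      = ∑ a, ∑ b, (pderiv l (fun y => jac φ y a i) p * jac φ p b j * H (φ p) a b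
        + jac φ p a i * pderiv l (fun y => jac φ y b j) p * H (φ p) a b
        + jac φ p a i * jac φ p b j
            * ∑ c, jac φ p c l * pderiv c (fun y => H y a b) (φ p)) := by
  have hev : (fun y => G y i j) =ᶠ[𝓝 p]
      fun y => ∑ a, ∑ b, jac φ y a i * jac φ y b j * H (φ y) a b := by
    filter_upwards [h.eq] with y hy
    rw [hy, Matrix.mul_apply]
    simp only [Matrix.mul_apply, Matrix.transpose_apply, Finset.sum_mul]
    rw [Finset.sum_comm]
    exact Finset.sum_congr rfl fun a _ => Finset.sum_congr rfl fun b _ => by ring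
  have hJ a i := (contDiffAt_jac h.smooth a i).differentiableAt_infty
  have hφ := h.smooth.differentiableAt_infty
  have hH a b := (h.metric'.smooth a b).differentiableAt_infty
  have hHφ a b : DifferentiableAt ℝ (fun y => H (φ y) a b) p := (hH a b).comp p hφ
  rw [pderiv_congr hev, pderiv_sum _ fun a _ => DifferentiableAt.fun_sum fun b _ =>
    ((hJ a i).fun_mul (hJ b j)).fun_mul (hHφ a b)]
  refine Finset.sum_congr rfl fun a _ => ?_
  rw [pderiv_sum _ fun b _ => ((hJ a i).fun_mul (hJ b j)).fun_mul (hHφ a b)]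
  refine Finset.sum_congr rfl fun b _ => ?_
  rw [pderiv_mul ((hJ a i).fun_mul (hJ b j)) (hHφ a b), pderiv_mul (hJ a i) (hJ b j),
    pderiv_comp (f := fun y => H y a b) (hH a b) hφ]
  simp only [jac, Matrix.of_apply]
  ring

theorem pderiv_jac_comm (a i j : Fin n) :
    pderiv i (fun y => jac φ y a j) p = pderiv j (fun y => jac φ y a i) p :=
  pderiv_comm (contDiffAt_component h.smooth a).two_of_infty i j

theorem christoffelFirst_eq (l i j : Fin n) :
    christoffelFirst G l i j p
      = 2 * ∑ a, ∑ b, pderiv i (fun y => jac φ y a j) p * jac φ p b l * H (φ p) a b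
        + ∑ a, ∑ b, ∑ c, jac φ p a l * (jac φ p b i * jac φ p c j)
            * christoffelFirst H a b c (φ p) := by
  set K := fun i j l => ∑ a, ∑ b, pderiv i (fun y => jac φ y a j) p * jac φ p b l * H (φ p) a b
    with hK
  set D := fun l i j => ∑ a, ∑ b, ∑ c, jac φ p a i * jac φ p b j *
    (jac φ p c l * pderiv c (fun y => H y a b) (φ p)) with hD
  have hsymm : ∀ a b, H (φ p) a b = H (φ p) b a := fun a b =>
    (h.metric'.symm_eventually a b).self_of_nhds
  have hKs i j l : K i j l = K j i l := by
    simp only [hK, h.pderiv_jac_comm _ i j]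
  have h1 l i j : pderiv l (fun y => G y i j) p = K l i j + K l j i + D l i j := by
    have e : K l j i
        = ∑ a, ∑ b, jac φ p a i * pderiv l (fun y => jac φ y b j) p * H (φ p) a b := by
      simp only [hK]
      rw [Finset.sum_comm]
      exact Finset.sum_congr rfl fun a _ => Finset.sum_congr rfl fun b _ => by
        rw [hsymm b a]; ring
    rw [h.pderiv_metric, e]
    simp only [hK, hD, Finset.sum_add_distrib, Finset.mul_sum]
  have h2 : ∑ a, ∑ b, ∑ c, jac φ p a l * (jac φ p b i * jac φ p c j)
            * christoffelFirst H a b c (φ p) = D i j l + D j i l - D l i j := by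
    have e1 : D i j l = ∑ a, ∑ b, ∑ c, jac φ p a l * (jac φ p b i * jac φ p c j)
        * pderiv b (fun y => H y c a) (φ p) := by
      simp only [hD]
      rw [Finset.sum_comm]
      refine Finset.sum_congr rfl fun a _ => ?_
      rw [Finset.sum_comm]
      exact Finset.sum_congr rfl fun b _ => Finset.sum_congr rfl fun c _ => by ring
    have e2 : D j i l = ∑ a, ∑ b, ∑ c, jac φ p a l * (jac φ p b i * jac φ p c j)
        * pderiv c (fun y => H y b a) (φ p) := by
      simp only [hD]
      rw [Finset.sum_comm]
      exact Finset.sum_congr rfl fun a _ => Finset.sum_congr rfl fun b _ =>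
        Finset.sum_congr rfl fun c _ => by ring
    have e3 : D l i j = ∑ a, ∑ b, ∑ c, jac φ p a l * (jac φ p b i * jac φ p c j)
        * pderiv a (fun y => H y b c) (φ p) := by
      simp only [hD]
      rw [Finset.sum_congr rfl fun b _ => Finset.sum_comm, Finset.sum_comm]
      exact Finset.sum_congr rfl fun a _ => Finset.sum_congr rfl fun b _ =>
        Finset.sum_congr rfl fun c _ => by ring
    rw [e1, e2, e3]
    simp only [← Finset.sum_add_distrib, ← Finset.sum_sub_distrib]
    exact Finset.sum_congr rfl fun a _ => Finset.sum_congr rfl fun b _ =>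
      Finset.sum_congr rfl fun c _ => by unfold christoffelFirst; ring
  rw [h2, christoffelFirst, h1, h1, h1, hKs l i j, hKs l j i, hKs j i l]
  ring

/-- The transformation law of the Christoffel symbols. -/
theorem christoffel_eq (k i j : Fin n) :
    ∑ c, jac φ p k c * christoffel G c i j p
      = ∑ b, ∑ c, jac φ p b i * jac φ p c j * christoffel H k b c (φ p)
        + pderiv i (fun y => jac φ y k j) p := by
  -- Both sides agree after multiplication by the invertible matrix `Jᵀ H`.
  have hlow (F : EuclideanSpace ℝ (Fin n) → Matrix (Fin n) (Fin n) ℝ)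
      (q : EuclideanSpace ℝ (Fin n)) (hq : (F q).det ≠ 0) (i j : Fin n) :
      F q *ᵥ (fun c => christoffel F c i j q) = fun l => 1 / 2 * christoffelFirst F l i j q := by
    have : (fun c => christoffel F c i j q)
        = (1 / 2 : ℝ) • ((F q)⁻¹ *ᵥ fun l => christoffelFirst F l i j q) := by
      ext c
      simp [RicciDeTurck.christoffel_eq, Matrix.mulVec, dotProduct]
    rw [this, Matrix.mulVec_smul, Matrix.mulVec_mulVec,
      Matrix.mul_nonsing_inv _ (isUnit_iff_ne_zero.2 hq), Matrix.one_mulVec]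
    rfl
  set L : Fin n → ℝ := jac φ p *ᵥ fun c => christoffel G c i j p with hL
  set R : Fin n → ℝ := fun k => ∑ b, ∑ c, jac φ p b i * jac φ p c j * christoffel H k b c (φ p)
        + pderiv i (fun y => jac φ y k j) p with hR
  suffices L = R from congrFun this k
  have hu : IsUnit ((jac φ p)ᵀ * H (φ p)) := by
    rw [Matrix.isUnit_iff_isUnit_det, Matrix.det_mul, Matrix.det_transpose]
    exact isUnit_iff_ne_zero.2 (mul_ne_zero h.det_jac_ne_zero h.metric'.det_ne_zero)
  apply Matrix.mulVec_injective_iff_isUnit.2 hu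
  have hsymm : ∀ a b, H (φ p) a b = H (φ p) b a := fun a b =>
    (h.metric'.symm_eventually a b).self_of_nhds
  rw [hL, Matrix.mulVec_mulVec, ← h.eq_self, hlow G p h.metric.det_ne_zero,
    ← Matrix.mulVec_mulVec]
  ext l
  have hHR : H (φ p) *ᵥ R = fun a =>
      ∑ b, ∑ c, jac φ p b i * jac φ p c j * (1 / 2 * christoffelFirst H a b c (φ p))
        + ∑ b, H (φ p) a b * pderiv i (fun y => jac φ y b j) p := by
    ext a
    simp only [hR, Matrix.mulVec, dotProduct, mul_add, Finset.sum_add_distrib]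
    congr 1
    simp only [Finset.mul_sum]
    rw [Finset.sum_comm]
    refine Finset.sum_congr rfl fun b _ => ?_
    rw [Finset.sum_comm]
    refine Finset.sum_congr rfl fun c _ => ?_
    have := congrFun (hlow H (φ p) h.metric'.det_ne_zero b c) a
    simp only [Matrix.mulVec, dotProduct] at this
    rw [← this, Finset.mul_sum]
    exact Finset.sum_congr rfl fun k _ => by ring
  rw [hHR, h.christoffelFirst_eq]
  simp only [Matrix.mulVec, dotProduct, Matrix.transpose_apply, mul_add, Finset.sum_add_distrib,
    Finset.mul_sum]
  rw [add_comm]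
  congr 1
  · exact Finset.sum_congr rfl fun a _ => Finset.sum_congr rfl fun b _ =>
      Finset.sum_congr rfl fun c _ => by ring
  · rw [Finset.sum_comm]
    exact Finset.sum_congr rfl fun a _ => Finset.sum_congr rfl fun b _ => by
      rw [hsymm b a]; ring

omit h in
/-- The DeTurck vector field transforms as a vector field. -/
theorem deTurckVector_eq (h : IsPullbackNear φ G H p) (h' : IsPullbackNear φ G' H' p) :
    (jac φ p *ᵥ fun k => deTurckVector G G' k p) = fun k => deTurckVector H H' k (φ p) := by
  ext k
  have hdiff i j : ∑ c, jac φ p k c * (christoffel G c i j p - christoffel G' c i j p)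
      = ∑ a, ∑ b, jac φ p a i * jac φ p b j
        * (christoffel H k a b (φ p) - christoffel H' k a b (φ p)) := by
    simp only [mul_sub, Finset.sum_sub_distrib, h.christoffel_eq, h'.christoffel_eq]
    ring
  have hinv a b : ∑ i, ∑ j, jac φ p a i * (G p)⁻¹ i j * jac φ p b j = (H (φ p))⁻¹ a b := by
    rw [← h.jac_mul_inv_mul]
    simp only [Matrix.mul_apply, Matrix.transpose_apply, Finset.sum_mul]
    rw [Finset.sum_comm]
  simp only [Matrix.mulVec, dotProduct, deTurckVector, Finset.mul_sum]
  rw [Finset.sum_comm]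
  trans ∑ i, ∑ j, (G p)⁻¹ i j * ∑ a, ∑ b, jac φ p a i * jac φ p b j
        * (christoffel H k a b (φ p) - christoffel H' k a b (φ p))
  · refine Finset.sum_congr rfl fun i _ => ?_
    rw [Finset.sum_comm]
    refine Finset.sum_congr rfl fun j _ => ?_
    rw [← hdiff, Finset.mul_sum]
    exact Finset.sum_congr rfl fun c _ => by ring
  · simp only [← hinv, Finset.sum_mul, Finset.mul_sum]
    rw [sum_sum_comm_sum_sum]
    exact Finset.sum_congr rfl fun a _ => Finset.sum_congr rfl fun b _ =>
      Finset.sum_congr rfl fun i _ => Finset.sum_congr rfl fun j _ => by ring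

omit h in
theorem normSqField_eq {W X : Fin n → EuclideanSpace ℝ (Fin n) → ℝ}
    (hWX : (jac φ p *ᵥ fun k => W k p) = fun k => X k (φ p))
    (hGH : G p = (jac φ p)ᵀ * H (φ p) * jac φ p) :
    normSqField G W p = normSqField H X (φ p) := by
  rw [normSqField_eq_dotProduct, normSqField_eq_dotProduct, ← hWX, hGH,
    ← Matrix.mulVec_mulVec, ← Matrix.mulVec_mulVec, Matrix.dotProduct_mulVec,
    Matrix.vecMul_transpose]

omit h in
theorem stressField_eq {W X : Fin n → EuclideanSpace ℝ (Fin n) → ℝ}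
    (h : IsPullbackNear φ G H p) (hG' : G' p = (jac φ p)ᵀ * H' (φ p) * jac φ p)
    (hWX : (jac φ p *ᵥ fun k => W k p) = fun k => X k (φ p)) :
    (jac φ p *ᵥ fun k => stressField G G' W k p) = fun k => stressField H H' X k (φ p) := by
  have hJ := isUnit_iff_ne_zero.2 h.det_jac_ne_zero
  have hconj : jac φ p * ((G p)⁻¹ * G' p) = ((H (φ p))⁻¹ * H' (φ p)) * jac φ p := by
    rw [← h.jac_mul_inv_mul, hG']
    simp only [Matrix.mul_assoc]
  have htr : ((G p)⁻¹ * G' p).trace = ((H (φ p))⁻¹ * H' (φ p)).trace := by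
    rw [← Matrix.nonsing_inv_mul_cancel_left _ ((G p)⁻¹ * G' p) hJ, hconj, Matrix.trace_mul_comm,
      Matrix.mul_assoc, Matrix.mul_nonsing_inv _ hJ, Matrix.mul_one]
  have key (F F' : EuclideanSpace ℝ (Fin n) → Matrix (Fin n) (Fin n) ℝ)
      (Z : Fin n → EuclideanSpace ℝ (Fin n) → ℝ) (q : EuclideanSpace ℝ (Fin n)) :
      (fun k => stressField F F' Z k q) = (1 / 2 * ((F q)⁻¹ * F' q).trace) • (fun k => Z k q)
        - ((F q)⁻¹ * F' q) *ᵥ fun k => Z k q := by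
    ext k
    simp [stressField]
  rw [key, key, Matrix.mulVec_sub, Matrix.mulVec_smul, Matrix.mulVec_mulVec, hconj,
    ← Matrix.mulVec_mulVec, hWX, htr]

end IsPullbackNear

/-- The Laplacian `gᵏˡ (∂ₖ ∂ₗ u - Γᵐₖₗ ∂ₘ u)` of the function `u` with respect to the metric `G`. -/
def laplacian (G : EuclideanSpace ℝ (Fin n) → Matrix (Fin n) (Fin n) ℝ)
    (u : EuclideanSpace ℝ (Fin n) → ℝ) (y : EuclideanSpace ℝ (Fin n)) : ℝ :=
  ∑ k, ∑ l, (G y)⁻¹ k l * (pderiv k (pderiv l u) y - ∑ m, christoffel G m k l y * pderiv m u y)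

/-- The divergence `∂ᵢ Xⁱ + Γᵏₖᵢ Xⁱ` of the vector field `X` with respect to the metric `G`. -/
def divergence (G : EuclideanSpace ℝ (Fin n) → Matrix (Fin n) (Fin n) ℝ)
    (X : Fin n → EuclideanSpace ℝ (Fin n) → ℝ) (y : EuclideanSpace ℝ (Fin n)) : ℝ :=
  ∑ i, pderiv i (X i) y + ∑ k, ∑ i, christoffel G k k i y * X i y

namespace IsPullbackNear

variable (h : IsPullbackNear φ G H p)
include h

theorem pderiv_jac_of_isNormalAt (hN : IsNormalAt G p) (k i j : Fin n) :
    pderiv i (fun y => jac φ y k j) p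
      = -∑ b, ∑ c, jac φ p b i * jac φ p c j * christoffel H k b c (φ p) := by
  have := h.christoffel_eq k i j
  simp only [hN.christoffel_eq_zero, mul_zero, Finset.sum_const_zero] at this
  linarith

theorem sum_jac_mul_jac (hN : IsNormalAt G p) (k l : Fin n) :
    ∑ i, jac φ p k i * jac φ p l i = (H (φ p))⁻¹ k l := by
  rw [← h.jac_mul_inv_mul, hN.inv_eq_one, Matrix.mul_one, Matrix.mul_apply]
  rfl

theorem laplacian_eq (hN : IsNormalAt G p) {u : EuclideanSpace ℝ (Fin n) → ℝ}
    (hu : ContDiffAt ℝ 2 u (φ p)) :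
    ∑ i, pderiv i (pderiv i (fun y => u (φ y))) p = laplacian H u (φ p) := by
  have hφ := h.smooth.differentiableAt_infty
  have hJ a i := (contDiffAt_jac h.smooth a i).differentiableAt_infty
  have hu' a : DifferentiableAt ℝ (pderiv a u) (φ p) :=
    (hu.pderiv (k := 1) (by norm_num) a).differentiableAt (by simp)
  have h1 i : pderiv i (fun y => u (φ y)) =ᶠ[𝓝 p] fun y => ∑ a, jac φ y a i * pderiv a u (φ y) := by
    filter_upwards [h.smooth.two_of_infty.eventually_two,
      h.smooth.continuousAt.eventually hu.eventually_two] with y hy1 hy2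
    exact pderiv_comp (hy2.differentiableAt (by simp)) (hy1.differentiableAt (by simp)) i
  have h2 i : pderiv i (pderiv i (fun y => u (φ y))) p
      = ∑ a, ∑ b, jac φ p a i * jac φ p b i * pderiv b (pderiv a u) (φ p)
        - ∑ a, (∑ b, ∑ c, jac φ p b i * jac φ p c i * christoffel H a b c (φ p))
            * pderiv a u (φ p) := by
    have hd a : DifferentiableAt ℝ (fun y => pderiv a u (φ y)) p := (hu' a).comp p hφ
    rw [pderiv_congr (h1 i), pderiv_sum _ fun a _ => (hJ a i).fun_mul (hd a),
      ← Finset.sum_sub_distrib]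
    refine Finset.sum_congr rfl fun a _ => ?_
    rw [pderiv_mul (hJ a i) (hd a), h.pderiv_jac_of_isNormalAt hN,
      pderiv_comp (hu' a) hφ, Finset.mul_sum, neg_mul, add_comm, ← sub_eq_add_neg]
    congr 1
    exact Finset.sum_congr rfl fun b _ => by simp only [jac, Matrix.of_apply]; ring
  simp only [h2, Finset.sum_sub_distrib, laplacian, mul_sub]
  congr 1
  · rw [Finset.sum_comm, Finset.sum_congr rfl fun a _ => Finset.sum_comm, Finset.sum_comm]
    refine Finset.sum_congr rfl fun b _ => Finset.sum_congr rfl fun a _ => ?_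
    rw [← h.sum_jac_mul_jac hN, Finset.sum_mul]
    exact Finset.sum_congr rfl fun i _ => by ring
  · simp only [← h.sum_jac_mul_jac hN, Finset.sum_mul, Finset.mul_sum]
    rw [sum_sum_comm_sum_sum]
    refine Finset.sum_congr rfl fun b _ => Finset.sum_congr rfl fun c _ => ?_
    rw [Finset.sum_comm]
    exact Finset.sum_congr rfl fun m _ => Finset.sum_congr rfl fun i _ => by ring

theorem divergence_eq (hN : IsNormalAt G p) {X Y : Fin n → EuclideanSpace ℝ (Fin n) → ℝ}
    (hX : ∀ i, DifferentiableAt ℝ (X i) p) (hY : ∀ i, DifferentiableAt ℝ (Y i) (φ p))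
    (hXY : ∀ᶠ y in 𝓝 p, ∀ k, Y k (φ y) = ∑ i, jac φ y k i * X i y) :
    ∑ a, pderiv a (X a) p = divergence H Y (φ p) := by
  have hφ := h.smooth.differentiableAt_infty
  have hJ a i := (contDiffAt_jac h.smooth a i).differentiableAt_infty
  have hu := isUnit_iff_ne_zero.2 h.det_jac_ne_zero
  -- Differentiate the relation between `X` and `Y`, and contract with the inverse of the Jacobian.
  have h1 k b : ∑ m, jac φ p m b * pderiv m (Y k) (φ p)
      = -∑ m, ∑ c, jac φ p m b * christoffel H k m c (φ p) * Y c (φ p)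
        + ∑ i, jac φ p k i * pderiv b (X i) p := by
    have hev : (fun y => Y k (φ y)) =ᶠ[𝓝 p] fun y => ∑ i, jac φ y k i * X i y := by
      filter_upwards [hXY] with y hy using hy k
    have e := pderiv_congr hev b
    rw [pderiv_comp (hY k) hφ, pderiv_sum _ fun i _ => (hJ k i).fun_mul (hX i)] at e
    simp only [pderiv_mul (hJ k _) (hX _), h.pderiv_jac_of_isNormalAt hN,
      Finset.sum_add_distrib] at e
    rw [show ∑ m, jac φ p m b * pderiv m (Y k) (φ p) = _ from e]
    congr 1
    simp only [hXY.self_of_nhds, neg_mul, Finset.sum_neg_distrib, Finset.mul_sum, Finset.sum_mul]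
    rw [Finset.sum_comm, Finset.sum_congr rfl fun m _ => Finset.sum_comm]
    congr 1
    exact Finset.sum_congr rfl fun m _ => Finset.sum_congr rfl fun c _ =>
      Finset.sum_congr rfl fun i _ => by ring
  have hinv k m : ∑ b, (jac φ p)⁻¹ b k * jac φ p m b = if m = k then 1 else 0 := by
    have := congrFun (congrFun (Matrix.mul_nonsing_inv _ hu) m) k
    rw [Matrix.mul_apply, Matrix.one_apply] at this
    rw [← this]
    exact Finset.sum_congr rfl fun b _ => mul_comm _ _
  have hinv' b i : ∑ k, (jac φ p)⁻¹ b k * jac φ p k i = if b = i then 1 else 0 := by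
    have := congrFun (congrFun (Matrix.nonsing_inv_mul _ hu) b) i
    rwa [Matrix.mul_apply, Matrix.one_apply] at this
  have h2 : ∑ k, ∑ b, (jac φ p)⁻¹ b k * ∑ m, jac φ p m b * pderiv m (Y k) (φ p)
      = ∑ k, pderiv k (Y k) (φ p) := by
    refine Finset.sum_congr rfl fun k _ => ?_
    simp only [Finset.mul_sum]
    rw [Finset.sum_comm]
    simp only [← mul_assoc, ← Finset.sum_mul, hinv]
    simp
  have h3 : ∑ k, ∑ b, (jac φ p)⁻¹ b k * ∑ m, ∑ c,
        jac φ p m b * christoffel H k m c (φ p) * Y c (φ p)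
      = ∑ k, ∑ c, christoffel H k k c (φ p) * Y c (φ p) := by
    refine Finset.sum_congr rfl fun k _ => ?_
    simp only [Finset.mul_sum]
    rw [Finset.sum_comm, Finset.sum_congr rfl fun m _ => Finset.sum_comm]
    simp only [← mul_assoc, ← Finset.sum_mul, hinv]
    simp
  have h4 : ∑ k, ∑ b, (jac φ p)⁻¹ b k * ∑ i, jac φ p k i * pderiv b (X i) p
      = ∑ a, pderiv a (X a) p := by
    rw [Finset.sum_comm]
    refine Finset.sum_congr rfl fun b _ => ?_
    simp only [Finset.mul_sum]
    rw [Finset.sum_comm]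
    simp only [← mul_assoc, ← Finset.sum_mul, hinv']
    simp
  simp only [h1, mul_add, mul_neg, Finset.sum_add_distrib, Finset.sum_neg_distrib, h3, h4] at h2
  rw [divergence]
  linarith

end IsPullbackNear

end ChangeOfCoordinates

/-! ### The Riemannian density -/

section Density

open Filter Topology Matrix

variable {n : ℕ} {p : EuclideanSpace ℝ (Fin n)}
  {G : EuclideanSpace ℝ (Fin n) → Matrix (Fin n) (Fin n) ℝ}

/-- Jacobi's formula for the derivative of a determinant. -/
theorem pderiv_det {A : EuclideanSpace ℝ (Fin n) → Matrix (Fin n) (Fin n) ℝ}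
    (hA : ∀ i j, DifferentiableAt ℝ (fun y => A y i j) p) (i : Fin n) :
    pderiv i (fun y => (A y).det) p
      = ∑ k, ∑ l, (A p).adjugate k l * pderiv i (fun y => A y l k) p := by
  have h1 : ∀ k, ∑ l, (A p).adjugate k l * pderiv i (fun y => A y l k) p
      = ((A p).updateCol k fun l => pderiv i (fun y => A y l k) p).det := by
    intro k
    rw [← Matrix.cramer_apply, Matrix.cramer_eq_adjugate_mulVec]
    rfl
  simp only [h1, Matrix.det_apply']
  rw [pderiv_sum]
  · rw [Finset.sum_comm]
    refine Finset.sum_congr rfl fun σ _ => ?_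
    have hprod := HasFDerivAt.finsetProd (u := Finset.univ) (x := p)
      (g := fun k y => A y (σ k) k) (g' := fun k => fderiv ℝ (fun y => A y (σ k) k) p)
      fun k _ => (hA _ _).hasFDerivAt
    rw [pderiv_const_mul _ hprod.differentiableAt, ← Finset.mul_sum]
    congr 1
    unfold pderiv
    rw [hprod.fderiv]
    simp only [_root_.sum_apply, _root_.smul_apply, smul_eq_mul]
    refine Finset.sum_congr rfl fun k _ => ?_
    rw [← Finset.mul_prod_erase _ _ (Finset.mem_univ k), Matrix.updateCol_self, mul_comm]
    congr 1
    exact Finset.prod_congr rfl fun j hj => by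
      rw [Matrix.updateCol_ne (Finset.ne_of_mem_erase hj)]
  · intro σ _
    exact (HasFDerivAt.finsetProd fun k _ => (hA (σ k) k).hasFDerivAt).differentiableAt.const_mul _

/-- The Riemannian density `√(det G)`. -/
def density (G : EuclideanSpace ℝ (Fin n) → Matrix (Fin n) (Fin n) ℝ)
    (y : EuclideanSpace ℝ (Fin n)) : ℝ := √(G y).det

namespace IsMetricNear

variable (hG : IsMetricNear G p)
include hG

theorem density_pos : 0 < density G p := Real.sqrt_pos.2 hG.posDef_self.det_pos

theorem density_smooth : ContDiffAt ℝ ∞ (density G) p :=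
  (contDiffAt_det hG.smooth).sqrt hG.det_ne_zero

theorem sum_christoffel (i : Fin n) :
    ∑ k, christoffel G k k i p
      = 1 / 2 * ∑ k, ∑ l, (G p)⁻¹ k l * pderiv i (fun y => G y k l) p := by
  have hs : ∀ k l, (G p)⁻¹ k l = (G p)⁻¹ l k := fun k l => by
    simpa using (hG.posDef_self.isHermitian.inv.apply k l).symm
  have h0 : ∑ k, ∑ l, ((G p)⁻¹ k l * pderiv k (fun y => G y i l) p
      - (G p)⁻¹ l k * pderiv l (fun y => G y i k) p) = 0 :=
    sum_sum_sub_swap fun k l => (G p)⁻¹ k l * pderiv k (fun y => G y i l) p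
  simp only [christoffel_eq, ← Finset.mul_sum]
  rw [← add_zero (∑ k, ∑ l, (G p)⁻¹ k l * pderiv i (fun y => G y k l) p), ← h0,
    ← Finset.sum_add_distrib]
  congr 1
  refine Finset.sum_congr rfl fun k _ => ?_
  rw [← Finset.sum_add_distrib]
  refine Finset.sum_congr rfl fun l _ => ?_
  have e : pderiv l (fun y => G y i k) p = pderiv l (fun y => G y k i) p :=
    pderiv_congr (hG.symm_eventually i k) l
  rw [christoffelFirst, e, hs l k]
  ring

theorem pderiv_density (i : Fin n) :
    pderiv i (density G) p = density G p * ∑ k, christoffel G k k i p := by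
  have hd := (contDiffAt_det hG.smooth).differentiableAt_infty
  have h1 : pderiv i (density G) p = 1 / (2 * density G p) * pderiv i (fun y => (G y).det) p := by
    unfold pderiv density
    rw [fderiv_sqrt hd hG.det_ne_zero]
    rfl
  have hadj : (G p).adjugate = (G p).det • (G p)⁻¹ := by
    rw [Matrix.inv_def, Ring.inverse_eq_inv', smul_smul, mul_inv_cancel₀ hG.det_ne_zero, one_smul]
  have hsq : (G p).det = density G p * density G p :=
    (Real.mul_self_sqrt hG.posDef_self.det_pos.le).symm
  rw [h1, pderiv_det fun i j => (hG.smooth i j).differentiableAt_infty, hG.sum_christoffel, hadj,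
    hsq]
  have hpos := hG.density_pos
  have e : ∀ k l, pderiv i (fun y => G y l k) p = pderiv i (fun y => G y k l) p := fun k l =>
    pderiv_congr (hG.symm_eventually l k) i
  simp only [Matrix.smul_apply, smul_eq_mul, e, mul_assoc, ← Finset.mul_sum]
  field_simp

theorem sum_pderiv_density_mul {X : Fin n → EuclideanSpace ℝ (Fin n) → ℝ}
    (hX : ∀ i, DifferentiableAt ℝ (X i) p) :
    ∑ i, pderiv i (fun y => density G y * X i y) p = density G p * divergence G X p := by
  have hd := hG.density_smooth.differentiableAt_infty
  simp only [pderiv_mul hd (hX _), hG.pderiv_density, divergence, mul_add, Finset.mul_sum,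
    Finset.sum_add_distrib, Finset.sum_mul]
  rw [add_comm, Finset.sum_comm (f := fun i k => density G p * christoffel G k k i p * X i p)]
  congr 1
  exact Finset.sum_congr rfl fun i _ => Finset.sum_congr rfl fun k _ => by ring

end IsMetricNear

theorem IsPullbackNear.density_eq {φ : EuclideanSpace ℝ (Fin n) → EuclideanSpace ℝ (Fin n)}
    {H : EuclideanSpace ℝ (Fin n) → Matrix (Fin n) (Fin n) ℝ} (h : IsPullbackNear φ G H p) :
    density G p = |(jac φ p).det| * density H (φ p) := by
  unfold density
  rw [h.eq_self, Matrix.det_mul, Matrix.det_mul, Matrix.det_transpose,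
    show ∀ a b : ℝ, a * b * a = a ^ 2 * b from fun a b => by ring,
    Real.sqrt_mul (sq_nonneg _), Real.sqrt_sq_eq_abs]

end Density

/-! ### The strong maximum principle -/

section MaximumPrinciple

open Filter Topology Matrix

variable {n : ℕ}

open scoped MatrixOrder in
theorem exists_eq_transpose_mul_self {A : Matrix (Fin n) (Fin n) ℝ} (hA : A.PosSemidef) :
    ∃ B : Matrix (Fin n) (Fin n) ℝ, A = Bᵀ * B := by
  obtain ⟨B, hB⟩ := CStarAlgebra.nonneg_iff_eq_star_mul_self.mp hA.nonneg
  exact ⟨B, by rw [hB, Matrix.star_eq_conjTranspose, Matrix.conjTranspose_eq_transpose_of_trivial]⟩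

theorem pderiv_eq_zero_of_isLocalMax {w : EuclideanSpace ℝ (Fin n) → ℝ}
    {z : EuclideanSpace ℝ (Fin n)} (hmax : IsLocalMax w z) (i : Fin n) : pderiv i w z = 0 := by
  simp [pderiv, hmax.fderiv_eq_zero]

/-- The Hessian at a local maximum is negative semidefinite. -/
theorem sum_pderiv_pderiv_nonpos_of_isLocalMax {w : EuclideanSpace ℝ (Fin n) → ℝ}
    {z : EuclideanSpace ℝ (Fin n)} (hw : ContDiffAt ℝ 2 w z) (hmax : IsLocalMax w z)
    (v : EuclideanSpace ℝ (Fin n)) :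
    ∑ l, ∑ k, v l * v k * pderiv k (pderiv l w) z ≤ 0 := by
  by_contra! hpos
  set c : ℝ → EuclideanSpace ℝ (Fin n) := fun t => z + t • v with hc
  have hc0 : c 0 = z := by simp [hc]
  have hcd t : HasDerivAt c v t := by
    simpa only [one_smul] using! ((hasDerivAt_id t).smul_const v).const_add z
  have hcc : Tendsto c (𝓝 0) (𝓝 z) := by
    have := (hcd 0).continuousAt.tendsto
    rwa [hc0] at this
  have h1 : deriv (fun t => w (c t)) =ᶠ[𝓝 0] fun t => ∑ l, v l * pderiv l w (c t) := by
    filter_upwards [hcc.eventually hw.eventually_two] with t ht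
    have := ((ht.differentiableAt (by simp)).hasFDerivAt.comp_hasDerivAt t (hcd t)).deriv
    rw [← fderiv_apply_eq_sum_pderiv]
    exact this
  have h2 : deriv (deriv fun t => w (c t)) 0
      = ∑ l, ∑ k, v l * v k * pderiv k (pderiv l w) z := by
    rw [h1.deriv_eq]
    have hd l : HasDerivAt (fun t => pderiv l w (c t)) (fderiv ℝ (pderiv l w) z v) 0 := by
      have hl : DifferentiableAt ℝ (pderiv l w) (c 0) := by
        rw [hc0]
        exact (hw.pderiv (k := 1) (by norm_num) l).differentiableAt (by simp)
      have := hl.hasFDerivAt.comp_hasDerivAt 0 (hcd 0)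
      rwa [hc0] at this
    have hsum := (HasDerivAt.fun_sum (u := Finset.univ) fun l _ => (hd l).const_mul (v l)).deriv
    rw [hsum]
    refine Finset.sum_congr rfl fun l _ => ?_
    rw [fderiv_apply_eq_sum_pderiv, Finset.mul_sum]
    exact Finset.sum_congr rfl fun k _ => by ring
  have hmax' : IsLocalMax (fun t => w (c t)) 0 := by
    have : ∀ᶠ t in 𝓝 0, w (c t) ≤ w z := hcc.eventually hmax
    filter_upwards [this] with t ht
    rwa [hc0]
  have hcont : ContinuousAt (fun t => w (c t)) 0 := by
    have hwc : ContinuousAt w (c 0) := by rw [hc0]; exact hw.continuousAt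
    exact hwc.comp (hcd 0).continuousAt
  have hmin : IsLocalMin (fun t => w (c t)) 0 :=
    isLocalMin_of_deriv_deriv_pos (by rw [h2]; exact hpos) hmax'.deriv_eq_zero hcont
  -- If the second derivative along the line were positive, `0` would also be a local minimum.
  have hconst : (fun t => w (c t)) =ᶠ[𝓝 0] fun _ => w (c 0) := by
    filter_upwards [hmax', hmin] with t h3 h4 using le_antisymm h3 h4
  have h5 : deriv (fun t => w (c t)) =ᶠ[𝓝 0] fun _ => (0 : ℝ) := by
    filter_upwards [hconst.eventuallyEq_nhds] with t ht
    rw [ht.deriv_eq, deriv_const]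
  rw [← h2, h5.deriv_eq, deriv_const] at hpos
  exact lt_irrefl _ hpos

/-- The second order operator `aₖₗ ∂ₖ ∂ₗ w + bₖ ∂ₖ w` without zeroth order term. -/
def ellipticOp (a : EuclideanSpace ℝ (Fin n) → Matrix (Fin n) (Fin n) ℝ)
    (b : Fin n → EuclideanSpace ℝ (Fin n) → ℝ) (w : EuclideanSpace ℝ (Fin n) → ℝ)
    (y : EuclideanSpace ℝ (Fin n)) : ℝ :=
  ∑ k, ∑ l, a y k l * pderiv k (pderiv l w) y + ∑ k, b k y * pderiv k w y

variable {a : EuclideanSpace ℝ (Fin n) → Matrix (Fin n) (Fin n) ℝ}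
  {b : Fin n → EuclideanSpace ℝ (Fin n) → ℝ}

theorem ellipticOp_nonpos_of_isLocalMax {w : EuclideanSpace ℝ (Fin n) → ℝ}
    {z : EuclideanSpace ℝ (Fin n)} (hw : ContDiffAt ℝ 2 w z) (hmax : IsLocalMax w z)
    (ha : (a z).PosSemidef) : ellipticOp a b w z ≤ 0 := by
  obtain ⟨B, hB⟩ := exists_eq_transpose_mul_self ha
  simp only [ellipticOp, pderiv_eq_zero_of_isLocalMax hmax, mul_zero, Finset.sum_const_zero,
    add_zero, hB, Matrix.mul_apply, Matrix.transpose_apply, Finset.sum_mul]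
  rw [Finset.sum_congr rfl fun k _ => Finset.sum_comm, Finset.sum_comm]
  refine Finset.sum_nonpos fun c _ => ?_
  refine le_trans (le_of_eq ?_)
    (sum_pderiv_pderiv_nonpos_of_isLocalMax hw hmax (WithLp.toLp 2 (B c)))
  rw [Finset.sum_comm]
  exact Finset.sum_congr rfl fun l _ => Finset.sum_congr rfl fun k _ => by
    simp only; ring

theorem ellipticOp_add_const_mul {u h : EuclideanSpace ℝ (Fin n) → ℝ}
    {z : EuclideanSpace ℝ (Fin n)} (hu : ContDiffAt ℝ 2 u z) (hh : ContDiffAt ℝ 2 h z) (ε : ℝ) :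
    ellipticOp a b (fun y => u y + ε * h y) z = ellipticOp a b u z + ε * ellipticOp a b h z := by
  have h1 {y} (huy : ContDiffAt ℝ 2 u y) (hhy : ContDiffAt ℝ 2 h y) (k : Fin n) :
      pderiv k (fun y => u y + ε * h y) y = pderiv k u y + ε * pderiv k h y := by
    have hd := hhy.differentiableAt (by simp)
    rw [pderiv_add (huy.differentiableAt (by simp)) (hd.const_mul ε), pderiv_const_mul _ hd]
  have h2 k l : pderiv k (pderiv l fun y => u y + ε * h y) z
      = pderiv k (pderiv l u) z + ε * pderiv k (pderiv l h) z := by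
    have hev : pderiv l (fun y => u y + ε * h y) =ᶠ[𝓝 z]
        fun y => pderiv l u y + ε * pderiv l h y := by
      filter_upwards [hu.eventually_two, hh.eventually_two] with y hy1 hy2 using h1 hy1 hy2 l
    have hu' := (hu.pderiv (k := 1) (by norm_num) l).differentiableAt (by simp)
    have hh' := (hh.pderiv (k := 1) (by norm_num) l).differentiableAt (by simp)
    rw [pderiv_congr hev, pderiv_add hu' (hh'.const_mul ε), pderiv_const_mul _ hh']
  simp only [ellipticOp, h1 hu hh, h2, mul_add, Finset.sum_add_distrib, Finset.mul_sum]
  have e1 : ∀ k l, a z k l * (ε * pderiv k (pderiv l h) z)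
      = ε * (a z k l * pderiv k (pderiv l h) z) := fun _ _ => by ring
  have e2 : ∀ k, b k z * (ε * pderiv k h z) = ε * (b k z * pderiv k h z) := fun _ => by ring
  simp only [e1, e2]
  ring

/-- The Gaussian barrier function `exp (-α |y - c|²)` of the Hopf lemma. -/
def barrier (α : ℝ) (c y : EuclideanSpace ℝ (Fin n)) : ℝ :=
  Real.exp (-α * ∑ i, (y i - c i) ^ 2)

theorem barrier_eq (α : ℝ) (c y : EuclideanSpace ℝ (Fin n)) :
    barrier α c y = Real.exp (-α * dist y c ^ 2) := by
  rw [barrier, EuclideanSpace.dist_eq, Real.sq_sqrt (Finset.sum_nonneg fun _ _ => sq_nonneg _)]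
  simp only [Real.dist_eq, sq_abs]

theorem contDiff_coord (i : Fin n) :
    ContDiff ℝ ∞ fun y : EuclideanSpace ℝ (Fin n) => y i :=
  (EuclideanSpace.proj i : EuclideanSpace ℝ (Fin n) →L[ℝ] ℝ).contDiff

theorem pderiv_coord (k i : Fin n) (y : EuclideanSpace ℝ (Fin n)) :
    pderiv k (fun y => y i) y = if i = k then 1 else 0 := by
  have h1 := (EuclideanSpace.proj i : EuclideanSpace ℝ (Fin n) →L[ℝ] ℝ).hasFDerivAt (x := y)
  have h2 := congrArg (fun L => L (EuclideanSpace.single k 1)) h1.fderiv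
  refine Eq.trans h2 ?_
  simp

theorem contDiff_barrier (α : ℝ) (c : EuclideanSpace ℝ (Fin n)) :
    ContDiff ℝ ∞ (barrier α c) :=
  (contDiff_const.mul (ContDiff.sum fun i _ => ((contDiff_coord i).sub contDiff_const).pow 2)).exp

theorem pderiv_barrier (α : ℝ) (c y : EuclideanSpace ℝ (Fin n)) (k : Fin n) :
    pderiv k (barrier α c) y = (-2 * α) * (y k - c k) * barrier α c y := by
  have hx i : DifferentiableAt ℝ (fun y : EuclideanSpace ℝ (Fin n) => y i - c i) y :=
    ((contDiff_coord i).contDiffAt.differentiableAt_infty).sub_const _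
  have hs : DifferentiableAt ℝ (fun y : EuclideanSpace ℝ (Fin n) =>
      -α * ∑ i, (y i - c i) ^ 2) y :=
    (DifferentiableAt.fun_sum fun i _ => (hx i).fun_pow 2).const_mul _
  have h1 : pderiv k (barrier α c) y
      = barrier α c y * pderiv k (fun y => -α * ∑ i, (y i - c i) ^ 2) y := by
    unfold pderiv
    have := hs.hasFDerivAt.exp.fderiv
    exact congrArg (fun L => L (EuclideanSpace.single k 1)) this
  have hx' i : pderiv k (fun y : EuclideanSpace ℝ (Fin n) => y i - c i) y
      = if i = k then 1 else 0 := by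
    rw [pderiv_sub (contDiff_coord i).contDiffAt.differentiableAt_infty
      (differentiableAt_const _), pderiv_coord, pderiv_const, sub_zero]
  rw [h1, pderiv_const_mul _ (DifferentiableAt.fun_sum fun i _ => (hx i).fun_pow 2),
    pderiv_sum _ fun i _ => (hx i).fun_pow 2]
  simp only [pow_two, pderiv_mul (hx _) (hx _), hx', Finset.sum_add_distrib]
  simp
  ring

theorem pderiv_pderiv_barrier (α : ℝ) (c y : EuclideanSpace ℝ (Fin n)) (k l : Fin n) :
    pderiv k (pderiv l (barrier α c)) y
      = (4 * α ^ 2 * ((y k - c k) * (y l - c l)) - 2 * α * if l = k then 1 else 0)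
        * barrier α c y := by
  have e : pderiv l (barrier α c) = fun y => (-2 * α) * (y l - c l) * barrier α c y :=
    funext fun y => pderiv_barrier α c y l
  have hl : DifferentiableAt ℝ (fun y : EuclideanSpace ℝ (Fin n) => y l) y :=
    (contDiff_coord l).contDiffAt.differentiableAt_infty
  have hx : DifferentiableAt ℝ (fun y : EuclideanSpace ℝ (Fin n) => y l - c l) y :=
    hl.sub_const _
  rw [e, pderiv_mul (hx.const_mul _) (contDiff_barrier α c).contDiffAt.differentiableAt_infty,
    pderiv_const_mul _ hx, pderiv_sub hl (differentiableAt_const _), pderiv_const, pderiv_coord,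
    pderiv_barrier]
  ring

/-- For `α` large, the barrier is a strict subsolution away from its centre. -/
theorem exists_ellipticOp_barrier_pos {c y : EuclideanSpace ℝ (Fin n)} (hcy : y ≠ c)
    (ha : (a y).PosDef) : ∃ α > 0, 0 < ellipticOp a b (barrier α c) y := by
  set d : Fin n → ℝ := fun k => y k - c k with hd
  have hd0 : d ≠ 0 := by
    intro h
    apply hcy
    ext k
    simpa [hd, sub_eq_zero] using congrFun h k
  set Q := ∑ k, ∑ l, a y k l * (d k * d l) with hQ
  have hQpos : 0 < Q := by
    have := ha.dotProduct_mulVec_pos hd0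
    refine this.trans_eq ?_
    simp only [dotProduct, Matrix.mulVec, hQ, Finset.mul_sum, star_trivial]
    exact Finset.sum_congr rfl fun k _ => Finset.sum_congr rfl fun l _ => by ring
  set T := ∑ k, ∑ l, a y k l * (if l = k then 1 else 0) + ∑ k, b k y * d k with hT
  have key α : ellipticOp a b (barrier α c) y = 2 * α * (2 * α * Q - T) * barrier α c y := by
    have e1 k l : a y k l * ((4 * α ^ 2 * ((y k - c k) * (y l - c l))
          - 2 * α * if l = k then 1 else 0) * barrier α c y)
        = 4 * α ^ 2 * barrier α c y * (a y k l * (d k * d l))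
          - 2 * α * barrier α c y * (a y k l * if l = k then 1 else 0) := by
      simp only [hd]; ring
    have e2 k : b k y * (-2 * α * (y k - c k) * barrier α c y)
        = -2 * α * barrier α c y * (b k y * d k) := by
      simp only [hd]; ring
    simp only [ellipticOp, pderiv_pderiv_barrier, pderiv_barrier, e1, e2, Finset.sum_sub_distrib,
      ← Finset.mul_sum]
    rw [← hQ, hT]
    ring
  -- This `α` makes `2 α Q = |T| + 1` exceed `T`.
  refine ⟨(|T| + 1) / (2 * Q), by positivity, ?_⟩
  rw [key]
  have : 2 * ((|T| + 1) / (2 * Q)) * Q = |T| + 1 := by field_simp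
  rw [this]
  have h1 : 0 < |T| + 1 - T := by linarith [le_abs_self T]
  have h2 : 0 < barrier ((|T| + 1) / (2 * Q)) c y := Real.exp_pos _
  have h3 : 0 < (|T| + 1) / (2 * Q) := by positivity
  positivity

/-- A point where a maximum of a subsolution is attained is not on the boundary of a ball on which
the subsolution is strictly smaller. -/
theorem hopf_contradiction {Ω : Set (EuclideanSpace ℝ (Fin n))} (hΩ : IsOpen Ω)
    (ha : ∀ y ∈ Ω, (a y).PosDef) (hac : ∀ k l, ContinuousOn (fun y => a y k l) Ω)
    (hbc : ∀ k, ContinuousOn (b k) Ω) {u : EuclideanSpace ℝ (Fin n) → ℝ}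
    (hu : ∀ y ∈ Ω, ContDiffAt ℝ 2 u y) (hLu : ∀ y ∈ Ω, 0 ≤ ellipticOp a b u y) {m : ℝ}
    (hum : ∀ y ∈ Ω, u y ≤ m) {y₁ c : EuclideanSpace ℝ (Fin n)} (hy₁ : y₁ ∈ Ω) (hy₁m : u y₁ = m)
    (hc : y₁ ≠ c) (hball : ∀ y ∈ Ω, dist y c ≤ dist y₁ c → y ≠ y₁ → u y < m) : False := by
  obtain ⟨α, hα, hpos⟩ := exists_ellipticOp_barrier_pos (b := b) hc (ha y₁ hy₁)
  have hh (y : EuclideanSpace ℝ (Fin n)) : ContDiffAt ℝ ∞ (barrier α c) y :=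
    (contDiff_barrier α c).contDiffAt
  have hcont : ContinuousAt (ellipticOp a b (barrier α c)) y₁ := by
    have hac' k l := (hac k l).continuousAt (hΩ.mem_nhds hy₁)
    have hbc' k := (hbc k).continuousAt (hΩ.mem_nhds hy₁)
    unfold ellipticOp
    refine ContinuousAt.add (tendsto_finsetSum _ fun k _ => tendsto_finsetSum _ fun l _ => ?_)
      (tendsto_finsetSum _ fun k _ => ?_)
    · exact (hac' k l).mul (((hh y₁).pderiv_infty l).pderiv_infty k).continuousAt
    · exact (hbc' k).mul ((hh y₁).pderiv_infty k).continuousAt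
  obtain ⟨δ, hδ, hδsub⟩ := Metric.nhds_basis_closedBall.mem_iff.1
    (inter_mem (hΩ.mem_nhds hy₁) (hcont.eventually (lt_mem_nhds hpos)))
  have hδΩ : Metric.closedBall y₁ δ ⊆ Ω := fun y hy => (hδsub hy).1
  have hδL : ∀ y ∈ Metric.closedBall y₁ δ, 0 < ellipticOp a b (barrier α c) y :=
    fun y hy => (hδsub hy).2
  have hucont : ContinuousOn u Ω := fun y hy => (hu y hy).continuousAt.continuousWithinAt
  -- On the part of the sphere that meets the ball around `c`, there is room below `m`.
  set K := Metric.sphere y₁ δ ∩ Metric.closedBall c (dist y₁ c) with hK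
  have hKc : IsCompact K := (isCompact_sphere _ _).inter_right Metric.isClosed_closedBall
  have hKΩ : K ⊆ Ω := fun y hy => hδΩ (Metric.sphere_subset_closedBall hy.1)
  obtain ⟨ε, hε, hεK⟩ : ∃ ε > 0, ∀ y ∈ K, u y + ε < m := by
    rcases K.eq_empty_or_nonempty with h0 | hne
    · exact ⟨1, one_pos, by simp [h0]⟩
    · obtain ⟨y₂, hy₂, hmax⟩ := hKc.exists_isMaxOn hne (hucont.mono hKΩ)
      have hlt : u y₂ < m := by
        refine hball y₂ (hKΩ hy₂) hy₂.2 ?_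
        rintro rfl
        have := hy₂.1
        simp at this
        exact hδ.ne this
      refine ⟨(m - u y₂) / 2, by linarith, fun y hy => ?_⟩
      have : u y ≤ u y₂ := hmax hy
      linarith
  -- The perturbation `w` is a strict subsolution near `y₁`, yet it has an interior maximum there:
  -- on the boundary sphere it stays below `w y₁`, by the choice of `ε` inside the ball around `c`,
  -- and because the barrier decreases away from `c` outside of it.
  set w : EuclideanSpace ℝ (Fin n) → ℝ := fun y => u y + ε * barrier α c y with hw
  have hwcont : ContinuousOn w (Metric.closedBall y₁ δ) :=
    (hucont.mono hδΩ).add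
      (continuousOn_const.mul (contDiff_barrier α c).continuous.continuousOn)
  obtain ⟨z, hz, hzmax⟩ := (isCompact_closedBall y₁ δ).exists_isMaxOn
    ⟨y₁, Metric.mem_closedBall_self hδ.le⟩ hwcont
  have hwy₁ : w y₁ ≤ w z := hzmax (Metric.mem_closedBall_self hδ.le)
  have hzball : z ∈ Metric.ball y₁ δ := by
    by_contra hzb
    have hzs : z ∈ Metric.sphere y₁ δ := by
      rw [Metric.mem_ball, not_lt] at hzb
      exact le_antisymm hz hzb
    have hb1 : barrier α c z ≤ 1 := by
      rw [barrier_eq]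
      exact Real.exp_le_one_iff.2 (by nlinarith [sq_nonneg (dist z c)])
    have hb0 : 0 < barrier α c y₁ := Real.exp_pos _
    by_cases hzc : z ∈ Metric.closedBall c (dist y₁ c)
    · have := hεK z ⟨hzs, hzc⟩
      simp only [hw] at hwy₁
      nlinarith
    · have hlt : dist y₁ c < dist z c := not_le.1 hzc
      have : barrier α c z < barrier α c y₁ := by
        rw [barrier_eq, barrier_eq, Real.exp_lt_exp]
        nlinarith [dist_nonneg (x := y₁) (y := c), mul_pos hα (sub_pos.2 hlt)]
      have huz := hum z (hδΩ hz)
      simp only [hw] at hwy₁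
      nlinarith
  have hloc : IsLocalMax w z := by
    filter_upwards [Metric.isOpen_ball.mem_nhds hzball] with y hy
    exact hzmax (Metric.ball_subset_closedBall hy)
  have huz := hu z (hδΩ hz)
  have hbz := (hh z).two_of_infty
  have h1 : ellipticOp a b w z ≤ 0 :=
    ellipticOp_nonpos_of_isLocalMax (huz.add (contDiffAt_const.mul hbz)) hloc
      (ha z (hδΩ hz)).posSemidef
  rw [hw, ellipticOp_add_const_mul huz hbz] at h1
  nlinarith [hLu z (hδΩ hz), hδL z hz, mul_pos hε (hδL z hz)]

/-- Hopf's strong maximum principle: a subsolution that attains a local maximum is constant near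
that point. -/
theorem eventually_eq_of_ellipticOp_nonneg {Ω : Set (EuclideanSpace ℝ (Fin n))} (hΩ : IsOpen Ω)
    (ha : ∀ y ∈ Ω, (a y).PosDef) (hac : ∀ k l, ContinuousOn (fun y => a y k l) Ω)
    (hbc : ∀ k, ContinuousOn (b k) Ω) {u : EuclideanSpace ℝ (Fin n) → ℝ}
    (hu : ∀ y ∈ Ω, ContDiffAt ℝ 2 u y) (hLu : ∀ y ∈ Ω, 0 ≤ ellipticOp a b u y) {m : ℝ}
    (hum : ∀ y ∈ Ω, u y ≤ m) {y₀ : EuclideanSpace ℝ (Fin n)} (hy₀ : y₀ ∈ Ω) (hy₀m : u y₀ = m) :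
    ∀ᶠ y in 𝓝 y₀, u y = m := by
  obtain ⟨r, hr, hrΩ⟩ := Metric.nhds_basis_closedBall.mem_iff.1 (hΩ.mem_nhds hy₀)
  rw [Metric.nhds_basis_ball.eventually_iff]
  refine ⟨r / 2, by positivity, fun c hc => ?_⟩
  by_contra hcm
  have hcy : dist c y₀ < r / 2 := hc
  have hsub : Metric.closedBall c (r / 2) ⊆ Ω := fun y hy => hrΩ <| by
    have : dist y c ≤ r / 2 := hy
    rw [Metric.mem_closedBall]
    linarith [dist_triangle y c y₀]
  have hucont : ContinuousOn u Ω := fun y hy => (hu y hy).continuousAt.continuousWithinAt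
  -- The point of the contact set `u = m` that is closest to `c`.
  set F := Metric.closedBall c (r / 2) ∩ u ⁻¹' {m} with hF
  have hFc : IsCompact F :=
    (isCompact_closedBall c (r / 2)).of_isClosed_subset
      ((hucont.mono hsub).preimage_isClosed_of_isClosed Metric.isClosed_closedBall
        isClosed_singleton) Set.inter_subset_left
  have hy₀F : y₀ ∈ F := ⟨by rw [Metric.mem_closedBall, dist_comm]; exact hcy.le, hy₀m⟩
  obtain ⟨y₁, hy₁, hmin⟩ := hFc.exists_isMinOn ⟨y₀, hy₀F⟩
    (continuous_id.dist continuous_const).continuousOn (f := fun y => dist y c)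
  have hy₁c : dist y₁ c ≤ r / 2 := hy₁.1
  have hne : y₁ ≠ c := by
    rintro rfl
    exact hcm hy₁.2
  -- Shrinking the ball towards the contact point makes the contact unique.
  refine hopf_contradiction hΩ ha hac hbc hu hLu hum (hsub hy₁.1) hy₁.2
    (c := midpoint ℝ y₁ c) (fun h => hne ((left_eq_midpoint_iff ℝ).1 h)) fun y hy hyd hyne => ?_
  rw [dist_left_midpoint] at hyd
  have hm : dist (midpoint ℝ y₁ c) c = 1 / 2 * dist y₁ c := by
    rw [dist_midpoint_right]; norm_num
  norm_num at hyd
  have hle : dist y c ≤ dist y₁ c := by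
    linarith [dist_triangle y (midpoint ℝ y₁ c) c]
  -- Equality of distances puts the midpoint of `y₁` and `c` on the segment from `y` to `c`, so that
  -- `y = y₁`.
  have hlt : dist y c < dist y₁ c := by
    refine lt_of_le_of_ne hle fun heq => hyne ?_
    have e1 : dist y (midpoint ℝ y₁ c) = 1 / 2 * dist y c := by
      linarith [dist_triangle y (midpoint ℝ y₁ c) c]
    have e2 : dist (midpoint ℝ y₁ c) c = (1 - 1 / 2) * dist y c := by
      rw [hm, heq]; ring
    have e3 : midpoint ℝ y₁ c = AffineMap.lineMap y c (1 / 2 : ℝ) :=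
      eq_lineMap_of_dist_eq_mul_of_dist_eq_mul e1 e2
    have e4 : midpoint ℝ y₁ c = midpoint ℝ y c := by
      rw [e3, midpoint]; norm_num
    have := congrArg (fun x => (2 : ℝ) • x - c) e4
    simp only [midpoint_eq_smul_add] at this
    simpa [smul_smul] using this.symm
  refine lt_of_le_of_ne (hum y hy) fun hyu => ?_
  have : dist y₁ c ≤ dist y c :=
    hmin ⟨Metric.mem_closedBall.2 (hle.trans hy₁c), hyu⟩
  linarith

end MaximumPrinciple

/-! ### Metrics in the charts of a manifold -/

section Charts

open Filter Topology Matrix IsManifold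

variable {n : ℕ} {M : Type*} [TopologicalSpace M]
  [ChartedSpace (EuclideanSpace ℝ (Fin n)) M] [IsManifold (𝓡 n) ∞ M]
  {e e' : OpenPartialHomeomorph M (EuclideanSpace ℝ (Fin n))}
  {y : EuclideanSpace ℝ (Fin n)} (g g' : Metric n M)

theorem contMDiffAt_coordVector (he : e ∈ maximalAtlas (𝓡 n) ∞ M) (hy : y ∈ e.target)
    (i : Fin n) :
    ContMDiffAt (𝓡 n) (𝓡 n).tangent ∞
      (fun z => (⟨e.symm z, coordVector e i z⟩ : TangentBundle (𝓡 n) M)) y := by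
  have h1 : ContMDiffOn (𝓡 n) (𝓡 n) ∞ e.symm e.target := contMDiffOn_symm_of_mem_maximalAtlas he
  have h2 := h1.contMDiffOn_tangentMapWithin (m := ∞) (by simp) e.open_target.uniqueMDiffOn
  have h3 : ContMDiff (𝓡 n) (𝓡 n).tangent ∞ (fun z : EuclideanSpace ℝ (Fin n) =>
      (⟨z, EuclideanSpace.single i (1 : ℝ)⟩ :
        TangentBundle (𝓡 n) (EuclideanSpace ℝ (Fin n)))) := by
    exact contMDiff_vectorSpace_iff_contDiff.2 contDiff_const
  have h5 : ContMDiffOn (𝓡 n) (𝓡 n).tangent ∞ (fun z : EuclideanSpace ℝ (Fin n) =>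
      tangentMapWithin (𝓡 n) (𝓡 n) e.symm e.target ⟨z, EuclideanSpace.single i (1 : ℝ)⟩)
      e.target := h2.comp h3.contMDiffOn fun z hz => hz
  refine (h5.contMDiffAt (e.open_target.mem_nhds hy)).congr_of_eventuallyEq ?_
  filter_upwards [e.open_target.mem_nhds hy] with z hz
  simp only [tangentMapWithin, coordVector]
  rw [mfderivWithin_of_isOpen e.open_target hz]

theorem contDiffAt_coordMetric (he : e ∈ maximalAtlas (𝓡 n) ∞ M) (hy : y ∈ e.target)
    (i j : Fin n) : ContDiffAt ℝ ∞ (fun z => coordMetric g e z i j) y := by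
  rw [← contMDiffAt_iff_contDiffAt]
  have hb : ContMDiffAt (𝓡 n) (𝓡 n) ∞ e.symm y := contMDiffAt_symm_of_mem_maximalAtlas he hy
  have : ContMDiffAt (𝓡 n) ((𝓡 n).prod 𝓘(ℝ)) ∞
      (fun z => Bundle.TotalSpace.mk' ℝ (E := Bundle.Trivial M ℝ) (e.symm z)
        (g.inner (e.symm z) (coordVector e i z) (coordVector e j z))) y := by
    apply ContMDiffAt.clm_bundle_apply₂ (F₁ := EuclideanSpace ℝ (Fin n))
      (F₂ := EuclideanSpace ℝ (Fin n))
    · exact ContMDiffAt.comp y g.contMDiff.contMDiffAt hb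
    · exact contMDiffAt_coordVector he hy i
    · exact contMDiffAt_coordVector he hy j
  simp only [Bundle.contMDiffAt_totalSpace] at this
  exact this.2

omit [IsManifold (𝓡 n) ∞ M] in
theorem hasMFDerivAt_symm (he : e ∈ maximalAtlas (𝓡 n) ∞ M) (hy : y ∈ e.target) :
    HasMFDerivAt (𝓡 n) (𝓡 n) e.symm y (mfderiv (𝓡 n) (𝓡 n) e.symm y) :=
  ((contMDiffAt_symm_of_mem_maximalAtlas he hy).mdifferentiableAt (by simp)).hasMFDerivAt

omit [IsManifold (𝓡 n) ∞ M] in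
theorem mfderiv_symm_injective (he : e ∈ maximalAtlas (𝓡 n) ∞ M) (hy : y ∈ e.target) :
    Function.Injective (mfderiv (𝓡 n) (𝓡 n) e.symm y) := by
  have h1 := ((contMDiffAt_of_mem_maximalAtlas he (e.map_target hy)).mdifferentiableAt
    (by simp)).hasMFDerivAt
  have h2 := h1.comp y (hasMFDerivAt_symm he hy)
  have h3 : HasMFDerivAt (𝓡 n) (𝓡 n) (e ∘ e.symm) y
      (ContinuousLinearMap.id ℝ (TangentSpace (𝓡 n) y)) := by
    refine (hasMFDerivAt_id y).congr_of_eventuallyEq ?_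
    filter_upwards [e.open_target.mem_nhds hy] with z hz using e.right_inv hz
  have h4 := hasMFDerivAt_unique h2 h3
  intro v w hvw
  have h5 : ∀ u, (mfderiv (𝓡 n) (𝓡 n) e (e.symm y)) (mfderiv (𝓡 n) (𝓡 n) e.symm y u) = u :=
    fun u => congrArg (fun L => L u) h4
  rw [← h5 v, ← h5 w, hvw]

omit [IsManifold (𝓡 n) ∞ M] in
theorem mfderiv_symm_eq_sum (v : EuclideanSpace ℝ (Fin n)) :
    mfderiv (𝓡 n) (𝓡 n) e.symm y v = ∑ i, v i • coordVector e i y := by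
  have hv : v = ∑ i, v i • EuclideanSpace.single i (1 : ℝ) := by
    ext j
    simp [Finset.sum_apply, Pi.single_apply]
  refine (congrArg (mfderiv (𝓡 n) (𝓡 n) e.symm y) hv).trans ?_
  refine (map_sum (mfderiv (𝓡 n) (𝓡 n) e.symm y) _ _).trans ?_
  exact Finset.sum_congr rfl fun i _ => map_smul (mfderiv (𝓡 n) (𝓡 n) e.symm y) _ _

theorem map_sum_smul_sum_smul {T : Type*} [AddCommGroup T] [Module ℝ T] [TopologicalSpace T]
    (B : T →L[ℝ] T →L[ℝ] ℝ) (v w : Fin n → ℝ) (a : Fin n → T) :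
    B (∑ i, v i • a i) (∑ j, w j • a j) = ∑ i, ∑ j, v i * w j * B (a i) (a j) := by
  simp only [map_sum, map_smul, _root_.sum_apply, _root_.smul_apply, smul_eq_mul, Finset.mul_sum]
  rw [Finset.sum_comm]
  exact Finset.sum_congr rfl fun i _ => Finset.sum_congr rfl fun j _ => by ring

theorem inner_mfderiv_symm (v w : EuclideanSpace ℝ (Fin n)) :
    g.inner (e.symm y) (mfderiv (𝓡 n) (𝓡 n) e.symm y v) (mfderiv (𝓡 n) (𝓡 n) e.symm y w)
      = ∑ i, ∑ j, v i * w j * coordMetric g e y i j := by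
  rw [mfderiv_symm_eq_sum, mfderiv_symm_eq_sum, map_sum_smul_sum_smul]
  rfl

theorem posDef_coordMetric (he : e ∈ maximalAtlas (𝓡 n) ∞ M) (hy : y ∈ e.target) :
    (coordMetric g e y).PosDef := by
  refine Matrix.PosDef.of_dotProduct_mulVec_pos ?_ fun x hx => ?_
  · ext i j
    simpa [coordMetric] using g.symm _ _ _
  · have h1 := inner_mfderiv_symm g (e := e) (y := y) (WithLp.toLp 2 x) (WithLp.toLp 2 x)
    have h2 : mfderiv (𝓡 n) (𝓡 n) e.symm y (WithLp.toLp 2 x : EuclideanSpace ℝ (Fin n)) ≠ 0 := by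
      intro h0
      apply hx
      have := mfderiv_symm_injective he hy (h0.trans (map_zero (mfderiv (𝓡 n) (𝓡 n) e.symm y)).symm)
      have h3 : (WithLp.toLp 2 x : EuclideanSpace ℝ (Fin n)) = 0 := this
      ext i
      exact congrArg (fun v : EuclideanSpace ℝ (Fin n) => v i) h3
    have h3 := g.pos _ _ h2
    rw [h1] at h3
    refine h3.trans_eq ?_
    simp only [dotProduct, Matrix.mulVec, Finset.mul_sum, star_trivial]
    exact Finset.sum_congr rfl fun i _ => Finset.sum_congr rfl fun j _ => by ring

theorem isMetricNear_coordMetric (he : e ∈ maximalAtlas (𝓡 n) ∞ M) (hy : y ∈ e.target) :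
    IsMetricNear (coordMetric g e) y where
  smooth := contDiffAt_coordMetric g he hy
  posDef := by
    filter_upwards [e.open_target.mem_nhds hy] with z hz using posDef_coordMetric g he hz

theorem inner_congr_point {x x' : M} (h : x = x') (v w : EuclideanSpace ℝ (Fin n)) :
    g.inner x (v : TangentSpace (𝓡 n) x) (w : TangentSpace (𝓡 n) x)
      = g.inner x' (v : TangentSpace (𝓡 n) x') (w : TangentSpace (𝓡 n) x') := by
  subst h; rfl

omit [IsManifold (𝓡 n) ∞ M] in
theorem contDiffAt_transition (he : e ∈ maximalAtlas (𝓡 n) ∞ M)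
    (he' : e' ∈ maximalAtlas (𝓡 n) ∞ M) (hy : y ∈ e.target) (hy' : e.symm y ∈ e'.source) :
    ContDiffAt ℝ ∞ (e' ∘ e.symm) y := by
  rw [← contMDiffAt_iff_contDiffAt]
  exact (contMDiffAt_of_mem_maximalAtlas he' hy').comp y
    (contMDiffAt_symm_of_mem_maximalAtlas he hy)

omit [ChartedSpace (EuclideanSpace ℝ (Fin n)) M] [IsManifold (𝓡 n) ∞ M] in
theorem eventually_mem_overlap (hy : y ∈ e.target) (hy' : e.symm y ∈ e'.source) :
    ∀ᶠ z in 𝓝 y, z ∈ e.target ∧ e.symm z ∈ e'.source :=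
  (e.open_target.eventually_mem hy).and
    ((e.continuousAt_symm hy).eventually (e'.open_source.mem_nhds hy'))

omit [IsManifold (𝓡 n) ∞ M] in
theorem mfderiv_symm_transition (he : e ∈ maximalAtlas (𝓡 n) ∞ M)
    (he' : e' ∈ maximalAtlas (𝓡 n) ∞ M) (hy : y ∈ e.target) (hy' : e.symm y ∈ e'.source)
    (v : EuclideanSpace ℝ (Fin n)) :
    (mfderiv (𝓡 n) (𝓡 n) e.symm y v : EuclideanSpace ℝ (Fin n))
      = mfderiv (𝓡 n) (𝓡 n) e'.symm ((e' ∘ e.symm) y) (fderiv ℝ (e' ∘ e.symm) y v) := by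
  have h1 : HasMFDerivAt (𝓡 n) (𝓡 n) (e' ∘ e.symm) y (fderiv ℝ (e' ∘ e.symm) y) :=
    (contDiffAt_transition he he' hy hy').differentiableAt_infty.hasFDerivAt.hasMFDerivAt
  have h2 := (hasMFDerivAt_symm he' (y := (e' ∘ e.symm) y) (e'.map_source hy')).comp y h1
  have h3 : (e'.symm ∘ (e' ∘ e.symm)) =ᶠ[𝓝 y] e.symm := by
    filter_upwards [eventually_mem_overlap hy hy'] with z hz using e'.left_inv hz.2
  have h4 := (h2.congr_of_eventuallyEq h3.symm).mfderiv
  exact congrArg (fun L => L v) h4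

/-- The transformation law of the components of a metric. -/
theorem isPullbackNear_transition (he : e ∈ maximalAtlas (𝓡 n) ∞ M)
    (he' : e' ∈ maximalAtlas (𝓡 n) ∞ M) (hy : y ∈ e.target) (hy' : e.symm y ∈ e'.source) :
    IsPullbackNear (e' ∘ e.symm) (coordMetric g e) (coordMetric g e') y where
  smooth := contDiffAt_transition he he' hy hy'
  metric := isMetricNear_coordMetric g he hy
  metric' := isMetricNear_coordMetric g he' (e'.map_source hy')
  eq := by
    filter_upwards [eventually_mem_overlap hy hy'] with z hz
    ext i j
    have hJ k a := jac_apply (contDiffAt_transition he he' hz.1 hz.2).differentiableAt_infty a k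
    have h1 : coordMetric g e z i j = g.inner (e'.symm ((e' ∘ e.symm) z))
        (mfderiv (𝓡 n) (𝓡 n) e'.symm ((e' ∘ e.symm) z)
          (fderiv ℝ (e' ∘ e.symm) z (EuclideanSpace.single i 1)))
        (mfderiv (𝓡 n) (𝓡 n) e'.symm ((e' ∘ e.symm) z)
          (fderiv ℝ (e' ∘ e.symm) z (EuclideanSpace.single j 1))) := by
      have hx : e.symm z = e'.symm ((e' ∘ e.symm) z) := (e'.left_inv hz.2).symm
      have e1 := mfderiv_symm_transition he he' hz.1 hz.2 (EuclideanSpace.single i 1)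
      have e2 := mfderiv_symm_transition he he' hz.1 hz.2 (EuclideanSpace.single j 1)
      refine Eq.trans ?_ (inner_congr_point g hx _ _)
      exact congrArg₂ (fun v w : EuclideanSpace ℝ (Fin n) =>
        g.inner (e.symm z) (v : TangentSpace (𝓡 n) (e.symm z)) (w : TangentSpace (𝓡 n) (e.symm z)))
        e1 e2
    rw [h1, inner_mfderiv_symm]
    simp only [← hJ, Matrix.mul_apply, Matrix.transpose_apply, Finset.sum_mul]
    rw [Finset.sum_comm]
    exact Finset.sum_congr rfl fun a _ => Finset.sum_congr rfl fun b _ => by ring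

end Charts

/-! ### Normal coordinates -/

section NormalCharts

open Filter Topology Matrix IsManifold

variable {n : ℕ}

theorem det_fderiv {φ : EuclideanSpace ℝ (Fin n) → EuclideanSpace ℝ (Fin n)}
    {y : EuclideanSpace ℝ (Fin n)} (hφ : DifferentiableAt ℝ φ y) :
    (fderiv ℝ φ y).det = (jac φ y).det := by
  rw [ContinuousLinearMap.det,
    ← LinearMap.det_toMatrix (EuclideanSpace.basisFun (Fin n) ℝ).toBasis]
  congr 1
  ext a i
  rw [LinearMap.toMatrix_apply, jac_apply hφ]
  simp

/-- The quadratic map `z ↦ y₀ + A z - ½ Γ(A z, A z)`, the inverse of a system of normal coordinates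
at `y₀` to second order. -/
def quadraticMap (y₀ : EuclideanSpace ℝ (Fin n)) (A : Matrix (Fin n) (Fin n) ℝ)
    (Γ : Fin n → Fin n → Fin n → ℝ) (z : EuclideanSpace ℝ (Fin n)) : EuclideanSpace ℝ (Fin n) :=
  WithLp.toLp 2 fun k => y₀ k + ∑ a, A k a * z a
    - 1 / 2 * ∑ b, ∑ c, Γ k b c * ((∑ a, A b a * z a) * ∑ a, A c a * z a)

variable (y₀ : EuclideanSpace ℝ (Fin n)) (A : Matrix (Fin n) (Fin n) ℝ)
  (Γ : Fin n → Fin n → Fin n → ℝ)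

theorem contDiff_linearForm (b : Fin n) :
    ContDiff ℝ ∞ fun z : EuclideanSpace ℝ (Fin n) => ∑ a, A b a * z a :=
  ContDiff.sum fun a _ => contDiff_const.mul (contDiff_coord a)

theorem pderiv_linearForm (b i : Fin n) (z : EuclideanSpace ℝ (Fin n)) :
    pderiv i (fun z : EuclideanSpace ℝ (Fin n) => ∑ a, A b a * z a) z = A b i := by
  have hc a : DifferentiableAt ℝ (fun z : EuclideanSpace ℝ (Fin n) => z a) z :=
    (contDiff_coord a).contDiffAt.differentiableAt_infty
  rw [pderiv_sum _ fun a _ => (hc a).const_mul _]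
  simp [pderiv_const_mul _ (hc _), pderiv_coord]

theorem contDiff_quadraticMap : ContDiff ℝ ∞ (quadraticMap y₀ A Γ) := by
  rw [contDiff_euclidean]
  intro k
  exact (contDiff_const.add (contDiff_linearForm A k)).sub (contDiff_const.mul
    (ContDiff.sum fun b _ => ContDiff.sum fun c _ => contDiff_const.mul
      ((contDiff_linearForm A b).mul (contDiff_linearForm A c))))

@[simp] theorem quadraticMap_zero : quadraticMap y₀ A Γ 0 = y₀ := by
  ext k
  simp [quadraticMap]

theorem jac_quadraticMap (k i : Fin n) (z : EuclideanSpace ℝ (Fin n)) :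
    jac (quadraticMap y₀ A Γ) z k i = A k i - 1 / 2 * ∑ b, ∑ c, Γ k b c *
      (A b i * (∑ a, A c a * z a) + (∑ a, A b a * z a) * A c i) := by
  have hl b : DifferentiableAt ℝ (fun z : EuclideanSpace ℝ (Fin n) => ∑ a, A b a * z a) z :=
    (contDiff_linearForm A b).contDiffAt.differentiableAt_infty
  have hq b c : DifferentiableAt ℝ (fun z : EuclideanSpace ℝ (Fin n) =>
      Γ k b c * ((∑ a, A b a * z a) * ∑ a, A c a * z a)) z :=
    ((hl b).fun_mul (hl c)).const_mul _
  have hs : DifferentiableAt ℝ (fun z : EuclideanSpace ℝ (Fin n) =>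
      ∑ b, ∑ c, Γ k b c * ((∑ a, A b a * z a) * ∑ a, A c a * z a)) z :=
    DifferentiableAt.fun_sum fun b _ => DifferentiableAt.fun_sum fun c _ => hq b c
  change pderiv i (fun z => y₀ k + ∑ a, A k a * z a
    - 1 / 2 * ∑ b, ∑ c, Γ k b c * ((∑ a, A b a * z a) * ∑ a, A c a * z a)) z = _
  rw [pderiv_sub ((hl k).const_add _) (hs.const_mul _),
    pderiv_add (differentiableAt_const _) (hl k), pderiv_const, zero_add, pderiv_linearForm,
    pderiv_const_mul _ hs, pderiv_sum _ fun b _ => DifferentiableAt.fun_sum fun c _ => hq b c]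
  congr 2
  refine Finset.sum_congr rfl fun b _ => ?_
  rw [pderiv_sum _ fun c _ => hq b c]
  refine Finset.sum_congr rfl fun c _ => ?_
  rw [pderiv_const_mul _ ((hl b).fun_mul (hl c)), pderiv_mul (hl b) (hl c), pderiv_linearForm,
    pderiv_linearForm]

theorem jac_quadraticMap_zero : jac (quadraticMap y₀ A Γ) 0 = A := by
  ext k i
  simp [jac_quadraticMap]

theorem pderiv_jac_quadraticMap_zero (hΓ : ∀ k b c, Γ k b c = Γ k c b) (k i j : Fin n) :
    pderiv i (fun z => jac (quadraticMap y₀ A Γ) z k j) 0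
      = -∑ b, ∑ c, A b i * A c j * Γ k b c := by
  have hl b : DifferentiableAt ℝ (fun z : EuclideanSpace ℝ (Fin n) => ∑ a, A b a * z a) 0 :=
    (contDiff_linearForm A b).contDiffAt.differentiableAt_infty
  have h1 b c : DifferentiableAt ℝ
      (fun z : EuclideanSpace ℝ (Fin n) => A b j * ∑ a, A c a * z a) 0 := (hl c).const_mul _
  have h2 b c : DifferentiableAt ℝ
      (fun z : EuclideanSpace ℝ (Fin n) => (∑ a, A b a * z a) * A c j) 0 := (hl b).mul_const _
  have hq b c : DifferentiableAt ℝ (fun z : EuclideanSpace ℝ (Fin n) => Γ k b c *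
      (A b j * (∑ a, A c a * z a) + (∑ a, A b a * z a) * A c j)) 0 :=
    ((h1 b c).fun_add (h2 b c)).const_mul _
  have hs : DifferentiableAt ℝ (fun z : EuclideanSpace ℝ (Fin n) => ∑ b, ∑ c, Γ k b c *
      (A b j * (∑ a, A c a * z a) + (∑ a, A b a * z a) * A c j)) 0 :=
    DifferentiableAt.fun_sum fun b _ => DifferentiableAt.fun_sum fun c _ => hq b c
  have hterm b c : pderiv i (fun z : EuclideanSpace ℝ (Fin n) => Γ k b c *
      (A b j * (∑ a, A c a * z a) + (∑ a, A b a * z a) * A c j)) 0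
      = A c i * A b j * Γ k c b + A b i * A c j * Γ k b c := by
    rw [pderiv_const_mul _ ((h1 b c).fun_add (h2 b c)), pderiv_add (h1 b c) (h2 b c),
      pderiv_const_mul _ (hl c), pderiv_mul (hl b) (differentiableAt_const _), pderiv_const,
      pderiv_linearForm, pderiv_linearForm, hΓ k c b]
    ring
  simp only [jac_quadraticMap]
  rw [pderiv_sub (differentiableAt_const _) (hs.const_mul _), pderiv_const, pderiv_const_mul _ hs,
    pderiv_sum _ fun b _ => DifferentiableAt.fun_sum fun c _ => hq b c,
    Finset.sum_congr rfl fun b _ => pderiv_sum _ (fun c _ => hq b c) i]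
  simp only [hterm, Finset.sum_add_distrib]
  rw [Finset.sum_comm (f := fun b c => A c i * A b j * Γ k c b)]
  ring

theorem IsMetricNear.christoffel_symm {G : EuclideanSpace ℝ (Fin n) → Matrix (Fin n) (Fin n) ℝ}
    {p : EuclideanSpace ℝ (Fin n)} (hG : IsMetricNear G p) (k i j : Fin n) :
    christoffel G k i j p = christoffel G k j i p := by
  simp only [christoffel_eq, christoffelFirst]
  congr 1
  refine Finset.sum_congr rfl fun l _ => ?_
  rw [pderiv_congr (hG.symm_eventually i j) l]
  ring

theorem isNormalAt_of_christoffel {G : EuclideanSpace ℝ (Fin n) → Matrix (Fin n) (Fin n) ℝ}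
    {p : EuclideanSpace ℝ (Fin n)} (hG : IsMetricNear G p) (h1 : G p = 1)
    (hΓ : ∀ k i j, christoffel G k i j p = 0) : IsNormalAt G p where
  eq_one := h1
  pderiv_eq_zero k i j := by
    have hc l a b : christoffelFirst G l a b p = 0 := by
      have := hΓ l a b
      simpa [christoffel_eq, h1, Matrix.one_apply] using this
    have e1 := hc j k i
    have e2 := hc i k j
    simp only [christoffelFirst] at e1 e2
    rw [pderiv_congr (hG.symm_eventually j i) k, pderiv_congr (hG.symm_eventually k j) i,
      pderiv_congr (hG.symm_eventually k i) j] at *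
    linarith

/-- A smooth map whose derivative at `z₀` is invertible restricts to a diffeomorphism of
neighbourhoods. -/
theorem exists_openPartialHomeomorph {ψ : EuclideanSpace ℝ (Fin n) → EuclideanSpace ℝ (Fin n)}
    (hψ : ContDiff ℝ ∞ ψ) {z₀ : EuclideanSpace ℝ (Fin n)} (h0 : (jac ψ z₀).det ≠ 0) :
    ∃ Φ : OpenPartialHomeomorph (EuclideanSpace ℝ (Fin n)) (EuclideanSpace ℝ (Fin n)),
      z₀ ∈ Φ.source ∧ (Φ : EuclideanSpace ℝ (Fin n) → EuclideanSpace ℝ (Fin n)) = ψ ∧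
        ContDiffOn ℝ ∞ Φ.symm Φ.target := by
  have hd z : DifferentiableAt ℝ ψ z := hψ.contDiffAt.differentiableAt_infty
  have hL z (hz : (fderiv ℝ ψ z).det ≠ 0) : HasFDerivAt ψ
      (((fderiv ℝ ψ z).toContinuousLinearEquivOfDetNeZero hz : _ ≃L[ℝ] _) :
        EuclideanSpace ℝ (Fin n) →L[ℝ] EuclideanSpace ℝ (Fin n)) z := by
    rw [ContinuousLinearMap.coe_toContinuousLinearEquivOfDetNeZero]
    exact (hd z).hasFDerivAt
  have h0' : (fderiv ℝ ψ z₀).det ≠ 0 := by rwa [det_fderiv (hd z₀)]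
  set Ψ := hψ.contDiffAt.toOpenPartialHomeomorph ψ (hL z₀ h0') (by simp) with hΨ
  have hopen : IsOpen {z | (fderiv ℝ ψ z).det ≠ 0} :=
    isOpen_ne_fun (ContinuousLinearMap.continuous_det.comp (hψ.continuous_fderiv (by simp)))
      continuous_const
  refine ⟨Ψ.restrOpen _ hopen, ⟨?_, h0'⟩, rfl, fun w hw => ?_⟩
  · exact ContDiffAt.mem_toOpenPartialHomeomorph_source _ _ _
  · have hs := (Ψ.restrOpen _ hopen).map_target hw
    exact ((Ψ.restrOpen _ hopen).contDiffAt_symm hw (hL _ hs.2) hψ.contDiffAt).contDiffWithinAt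

variable {M : Type*} [TopologicalSpace M]
  [ChartedSpace (EuclideanSpace ℝ (Fin n)) M] [IsManifold (𝓡 n) ∞ M]
  {e : OpenPartialHomeomorph M (EuclideanSpace ℝ (Fin n))} (g : Metric n M)

/-- Every point of a Riemannian manifold is the centre of a chart that is normal to first order. -/
theorem exists_isNormalAt (he : e ∈ maximalAtlas (𝓡 n) ∞ M) {y₀ : EuclideanSpace ℝ (Fin n)}
    (hy₀ : y₀ ∈ e.target) :
    ∃ f ∈ maximalAtlas (𝓡 n) ∞ M, ∃ z ∈ f.target, f.symm z = e.symm y₀ ∧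
      IsNormalAt (coordMetric g f) z := by
  -- `A = B⁻¹` makes the metric the identity at the point, and the quadratic term of `ψ` cancels the
  -- Christoffel symbols there.
  have hG := isMetricNear_coordMetric g he hy₀
  obtain ⟨B, hB⟩ := exists_eq_transpose_mul_self hG.posDef_self.posSemidef
  have hBdet : IsUnit B.det := by
    have := hG.det_ne_zero
    rw [hB, Matrix.det_mul] at this
    exact isUnit_iff_ne_zero.2 (right_ne_zero_of_mul this)
  set A := B⁻¹ with hA
  set Γ := fun k b c => christoffel (coordMetric g e) k b c y₀ with hΓ
  set ψ := quadraticMap y₀ A Γ with hψ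
  have hψs : ContDiff ℝ ∞ ψ := contDiff_quadraticMap _ _ _
  have hψ0 : ψ 0 = y₀ := quadraticMap_zero _ _ _
  have hdet : (jac ψ 0).det ≠ 0 := by
    rw [hψ, jac_quadraticMap_zero, hA]
    exact (Matrix.isUnit_nonsing_inv_det _ hBdet).ne_zero
  obtain ⟨Φ, h0, hΦψ, hΦs⟩ := exists_openPartialHomeomorph hψs hdet
  set f := e.trans Φ.symm with hf
  have hft : (0 : EuclideanSpace ℝ (Fin n)) ∈ f.target := by
    rw [hf, OpenPartialHomeomorph.trans_target]
    refine ⟨h0, ?_⟩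
    simp only [OpenPartialHomeomorph.symm_symm, Set.mem_preimage, hΦψ, hψ0, hy₀]
  have hfz z : f.symm z = e.symm (ψ z) := by rw [← hΦψ]; rfl
  have hfm : f ∈ maximalAtlas (𝓡 n) ∞ M := by
    refine OpenPartialHomeomorph.mem_maximalAtlas_of_contMDiffOn _ ?_ ?_
    · have h1 : ContMDiffOn (𝓡 n) (𝓡 n) ∞ Φ.symm Φ.target := hΦs.contMDiffOn
      have h2 := contMDiffOn_of_mem_maximalAtlas he
      exact h1.comp (h2.mono fun x hx => hx.1) fun x hx => hx.2
    · have h1 : ContMDiffOn (𝓡 n) (𝓡 n) ∞ Φ Φ.source := by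
        rw [hΦψ]
        exact hψs.contDiffOn.contMDiffOn
      have h2 := contMDiffOn_symm_of_mem_maximalAtlas he
      exact h2.comp (h1.mono fun x hx => hx.1) fun x hx => hx.2
  refine ⟨f, hfm, 0, hft, by rw [hfz, hψ0], ?_⟩
  have hsrc : f.symm 0 ∈ e.source := by rw [hfz, hψ0]; exact e.map_target hy₀
  have hP := isPullbackNear_transition g hfm he hft hsrc
  have hφψ : (e ∘ f.symm) =ᶠ[𝓝 0] ψ := by
    have : ∀ᶠ z in 𝓝 (0 : EuclideanSpace ℝ (Fin n)), ψ z ∈ e.target :=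
      hψs.continuous.continuousAt.eventually (by rw [hψ0]; exact e.open_target.eventually_mem hy₀)
    filter_upwards [this] with z hz
    simp only [Function.comp, hfz, e.right_inv hz]
  have hjac : jac (e ∘ f.symm) =ᶠ[𝓝 0] jac ψ := by
    filter_upwards [hφψ.eventuallyEq_nhds] with z hz
    ext k i
    exact pderiv_congr (hz.fun_comp fun w : EuclideanSpace ℝ (Fin n) => w k) i
  have hφ0 : (e ∘ f.symm) 0 = y₀ := hφψ.self_of_nhds.trans hψ0
  have hJ0 : jac (e ∘ f.symm) 0 = A := by
    rw [hjac.self_of_nhds, hψ, jac_quadraticMap_zero]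
  have hone : coordMetric g f 0 = 1 := by
    rw [hP.eq_self, hJ0, hφ0, hB, Matrix.mul_assoc, Matrix.mul_assoc,
      Matrix.mul_nonsing_inv _ hBdet, Matrix.mul_one, ← Matrix.transpose_mul,
      Matrix.mul_nonsing_inv _ hBdet, Matrix.transpose_one]
  refine isNormalAt_of_christoffel (isMetricNear_coordMetric g hfm hft) hone fun k i j => ?_
  have hlaw k : ∑ c, A k c * christoffel (coordMetric g f) c i j 0 = 0 := by
    have := hP.christoffel_eq k i j
    have hpj : pderiv i (fun z => jac (e ∘ f.symm) z k j) 0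
        = pderiv i (fun z => jac ψ z k j) 0 :=
      pderiv_congr (hjac.fun_comp fun m : Matrix (Fin n) (Fin n) ℝ => m k j) i
    rw [hpj, hψ, pderiv_jac_quadraticMap_zero _ _ _ fun k b c => hG.christoffel_symm k b c,
      hJ0, hφ0] at this
    rw [this]
    simp
  have hvec : A *ᵥ (fun c => christoffel (coordMetric g f) c i j 0) = 0 := funext hlaw
  have hinj := Matrix.mulVec_injective_iff_isUnit.2
    ((Matrix.isUnit_iff_isUnit_det _).2 (Matrix.isUnit_nonsing_inv_det _ hBdet))
  exact congrFun (hinj (hvec.trans (Matrix.mulVec_zero _).symm)) k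

end NormalCharts

/-! ### The DeTurck vector field of a stationary metric is parallel -/

section Parallel

open Filter Topology Matrix IsManifold

variable {n : ℕ} {M : Type*} [TopologicalSpace M]
  [ChartedSpace (EuclideanSpace ℝ (Fin n)) M] [IsManifold (𝓡 n) ∞ M]
  {e f : OpenPartialHomeomorph M (EuclideanSpace ℝ (Fin n))}
  {y z : EuclideanSpace ℝ (Fin n)} (g g' : Metric n M)

/-- The components of the DeTurck vector field in the chart `e`. -/
def coordDeTurck (e : OpenPartialHomeomorph M (EuclideanSpace ℝ (Fin n))) :
    Fin n → EuclideanSpace ℝ (Fin n) → ℝ :=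
  deTurckVector (coordMetric g e) (coordMetric g' e)

theorem contDiffAt_coordDeTurck (he : e ∈ maximalAtlas (𝓡 n) ∞ M) (hy : y ∈ e.target)
    (k : Fin n) : ContDiffAt ℝ ∞ (coordDeTurck g g' e k) y :=
  (isMetricNear_coordMetric g he hy).deTurckVector_smooth (isMetricNear_coordMetric g' he hy) k

theorem jac_mulVec_coordDeTurck (hf : f ∈ maximalAtlas (𝓡 n) ∞ M)
    (he : e ∈ maximalAtlas (𝓡 n) ∞ M) (hz : z ∈ f.target) (hz' : f.symm z ∈ e.source) :
    (jac (e ∘ f.symm) z *ᵥ fun k => coordDeTurck g g' f k z)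
      = fun k => coordDeTurck g g' e k ((e ∘ f.symm) z) :=
  (isPullbackNear_transition g hf he hz hz').deTurckVector_eq
    (isPullbackNear_transition g' hf he hz hz')

/-- The squared length, in the metric `g₀`, of the DeTurck vector field of `g` with respect to
`g'`. -/
def normSqDeTurck (g₀ : Metric n M) (x : M) : ℝ :=
  normSqField (coordMetric g₀ (chartAt _ x)) (coordDeTurck g g' (chartAt _ x)) (chartAt _ x x)

theorem normSqField_transition (g₀ : Metric n M) (hf : f ∈ maximalAtlas (𝓡 n) ∞ M)
    (he : e ∈ maximalAtlas (𝓡 n) ∞ M) (hz : z ∈ f.target) (hz' : f.symm z ∈ e.source) :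
    normSqField (coordMetric g₀ f) (coordDeTurck g g' f) z
      = normSqField (coordMetric g₀ e) (coordDeTurck g g' e) ((e ∘ f.symm) z) :=
  IsPullbackNear.normSqField_eq (jac_mulVec_coordDeTurck g g' hf he hz hz')
    (isPullbackNear_transition g₀ hf he hz hz').eq_self

theorem normSqDeTurck_symm (g₀ : Metric n M) (he : e ∈ maximalAtlas (𝓡 n) ∞ M)
    (hy : y ∈ e.target) :
    normSqDeTurck g g' g₀ (e.symm y)
      = normSqField (coordMetric g₀ e) (coordDeTurck g g' e) y :=
  (normSqField_transition g g' g₀ he (chart_mem_maximalAtlas _) hy (mem_chart_source _ _)).symm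

theorem contDiffAt_normSqField (g₀ : Metric n M) (he : e ∈ maximalAtlas (𝓡 n) ∞ M)
    (hy : y ∈ e.target) :
    ContDiffAt ℝ ∞ (normSqField (coordMetric g₀ e) (coordDeTurck g g' e)) y :=
  ContDiffAt.sum fun i _ => ContDiffAt.sum fun j _ => (contDiffAt_coordMetric g₀ he hy i j).mul
    ((contDiffAt_coordDeTurck g g' he hy i).mul (contDiffAt_coordDeTurck g g' he hy j))

theorem continuous_normSqDeTurck (g₀ : Metric n M) : Continuous (normSqDeTurck g g' g₀) := by
  rw [continuous_iff_continuousAt]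
  intro x
  set e := chartAt (EuclideanSpace ℝ (Fin n)) x with he
  have hem : e ∈ maximalAtlas (𝓡 n) ∞ M := chart_mem_maximalAtlas _
  have hx : x ∈ e.source := mem_chart_source _ x
  have h1 : ContinuousAt
      (fun x' => normSqField (coordMetric g₀ e) (coordDeTurck g g' e) (e x')) x :=
    (contDiffAt_normSqField g g' g₀ hem (e.map_source hx)).continuousAt.comp (e.continuousAt hx)
  refine h1.congr ?_
  filter_upwards [e.open_source.mem_nhds hx] with x' hx'
  rw [← normSqDeTurck_symm g g' g₀ hem (e.map_source hx'), e.left_inv hx']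

variable {g g'}

theorem bochner_of_isNormalAt (hst : IsStationary g g') (hf : f ∈ maximalAtlas (𝓡 n) ∞ M)
    (hz : z ∈ f.target) (hN : IsNormalAt (coordMetric g f) z) :
    ∑ a, pderiv a (pderiv a (normSqField (coordMetric g f) (coordDeTurck g g' f))) z
        - 2 * ∑ k, coordDeTurck g g' f k z
          * pderiv k (normSqField (coordMetric g f) (coordDeTurck g g' f)) z
      = 2 * ∑ a, ∑ i, (pderiv a (coordDeTurck g g' f i) z) ^ 2 := by
  refine hN.bochner (isMetricNear_coordMetric g hf hz)
    (fun k => contDiffAt_coordDeTurck g g' hf hz k) ?_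
  filter_upwards [f.open_target.mem_nhds hz] with w hw i j using hst f hf w hw i j

/-- In every chart, `|V|²` is a subsolution of the operator `Δ - 2 V`. -/
theorem laplacian_normSqField_nonneg (hst : IsStationary g g')
    (he : e ∈ maximalAtlas (𝓡 n) ∞ M) (hy : y ∈ e.target) :
    0 ≤ laplacian (coordMetric g e) (normSqField (coordMetric g e) (coordDeTurck g g' e)) y
      - 2 * ∑ k, coordDeTurck g g' e k y
        * pderiv k (normSqField (coordMetric g e) (coordDeTurck g g' e)) y := by
  obtain ⟨f, hf, z, hz, hzy, hN⟩ := exists_isNormalAt g he hy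
  have hz' : f.symm z ∈ e.source := by rw [hzy]; exact e.map_target hy
  have hφz : (e ∘ f.symm) z = y := by simp [hzy, e.right_inv hy]
  have hP := isPullbackNear_transition g hf he hz hz'
  set u := normSqField (coordMetric g e) (coordDeTurck g g' e) with hu
  have hus : ContDiffAt ℝ ∞ u ((e ∘ f.symm) z) := by
    rw [hφz]; exact contDiffAt_normSqField g g' g he hy
  have hev : normSqField (coordMetric g f) (coordDeTurck g g' f)
      =ᶠ[𝓝 z] fun w => u ((e ∘ f.symm) w) := by
    filter_upwards [eventually_mem_overlap hz hz'] with w hw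
    exact normSqField_transition g g' g hf he hw.1 hw.2
  have hB := bochner_of_isNormalAt hst hf hz hN
  have h1 : ∑ a, pderiv a (pderiv a (normSqField (coordMetric g f) (coordDeTurck g g' f))) z
      = laplacian (coordMetric g e) u y := by
    rw [← hφz, ← hP.laplacian_eq hN hus.two_of_infty]
    exact Finset.sum_congr rfl fun a _ => pderiv_congr (pderiv_eventuallyEq hev a) a
  have h2 : ∑ k, coordDeTurck g g' f k z
        * pderiv k (normSqField (coordMetric g f) (coordDeTurck g g' f)) z
      = ∑ k, coordDeTurck g g' e k y * pderiv k u y := by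
    have hV := jac_mulVec_coordDeTurck g g' hf he hz hz'
    have e1 k : pderiv k (normSqField (coordMetric g f) (coordDeTurck g g' f)) z
        = ∑ a, jac (e ∘ f.symm) z a k * pderiv a u y := by
      rw [pderiv_congr hev, pderiv_comp hus.differentiableAt_infty
        hP.smooth.differentiableAt_infty, hφz]
      rfl
    have e2 a : coordDeTurck g g' e a y
        = ∑ k, jac (e ∘ f.symm) z a k * coordDeTurck g g' f k z := by
      have := congrFun hV a
      rw [hφz] at this
      exact this.symm
    simp only [e1, e2, Finset.mul_sum, Finset.sum_mul]
    rw [Finset.sum_comm]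
    exact Finset.sum_congr rfl fun a _ => Finset.sum_congr rfl fun k _ => by ring
  rw [h1, h2] at hB
  rw [hB]
  exact mul_nonneg zero_le_two
    (Finset.sum_nonneg fun a _ => Finset.sum_nonneg fun i _ => sq_nonneg _)

/-- If `|V|²` attains its maximum over an open set, it is constant near that point. -/
theorem eventually_normSqDeTurck_eq (hst : IsStationary g g') {U : Set M} (hU : IsOpen U) {x : M}
    (hx : x ∈ U) (hmax : ∀ x' ∈ U, normSqDeTurck g g' g x' ≤ normSqDeTurck g g' g x) :
    ∀ᶠ x' in 𝓝 x, normSqDeTurck g g' g x' = normSqDeTurck g g' g x := by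
  set e := chartAt (EuclideanSpace ℝ (Fin n)) x with he
  have hem : e ∈ maximalAtlas (𝓡 n) ∞ M := chart_mem_maximalAtlas _
  have hxs : x ∈ e.source := mem_chart_source _ x
  set G := coordMetric g e with hG
  set W := coordDeTurck g g' e with hW
  set u := normSqField G W with hu
  have hΩ : IsOpen (e.target ∩ e.symm ⁻¹' U) := e.isOpen_inter_preimage_symm hU
  have hGn : ∀ y ∈ e.target, IsMetricNear G y := fun y hy => isMetricNear_coordMetric g hem hy
  have hux : u (e x) = normSqDeTurck g g' g x := by
    rw [hu, hG, hW, ← normSqDeTurck_symm g g' g hem (e.map_source hxs), e.left_inv hxs]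
  -- The first order coefficients of the operator `Δ - 2 V` in the chart.
  set b : Fin n → EuclideanSpace ℝ (Fin n) → ℝ := fun m y =>
    -(∑ k, ∑ l, (G y)⁻¹ k l * christoffel G m k l y) - 2 * W m y with hb
  have hop : ∀ y, ellipticOp (fun y => (G y)⁻¹) b u y
      = laplacian G u y - 2 * ∑ k, W k y * pderiv k u y := by
    intro y
    have e1 : ∑ k, ∑ l, (G y)⁻¹ k l * ∑ m, christoffel G m k l y * pderiv m u y
        = ∑ m, (∑ k, ∑ l, (G y)⁻¹ k l * christoffel G m k l y) * pderiv m u y := by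
      simp only [Finset.mul_sum, Finset.sum_mul]
      rw [Finset.sum_congr rfl fun k _ => Finset.sum_comm, Finset.sum_comm]
      exact Finset.sum_congr rfl fun m _ => Finset.sum_congr rfl fun k _ =>
        Finset.sum_congr rfl fun l _ => by ring
    simp only [ellipticOp, laplacian, hb, mul_sub, sub_mul, neg_mul, Finset.sum_sub_distrib,
      Finset.sum_neg_distrib, e1, mul_assoc, ← Finset.mul_sum]
    ring
  have hev := eventually_eq_of_ellipticOp_nonneg (a := fun y => (G y)⁻¹) (b := b) (u := u)
    (m := normSqDeTurck g g' g x) hΩ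
    (fun y hy => (hGn y hy.1).posDef_self.inv)
    (fun k l y hy => ((hGn y hy.1).inv_smooth k l).continuousAt.continuousWithinAt)
    (fun m y hy => by
      have hc : ContDiffAt ℝ ∞ (b m) y :=
        (ContDiffAt.neg (ContDiffAt.sum fun k _ => ContDiffAt.sum fun l _ =>
          ((hGn y hy.1).inv_smooth k l).mul ((hGn y hy.1).christoffel_smooth m k l))).sub
          (contDiffAt_const.mul (contDiffAt_coordDeTurck g g' hem hy.1 m))
      exact hc.continuousAt.continuousWithinAt)
    (fun y hy => (contDiffAt_normSqField g g' g hem hy.1).two_of_infty)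
    (fun y hy => by rw [hop]; exact laplacian_normSqField_nonneg hst hem hy.1)
    (fun y hy => by
      rw [hu, hG, hW, ← normSqDeTurck_symm g g' g hem hy.1]
      exact hmax _ hy.2)
    (y₀ := e x) ⟨e.map_source hxs, by simpa [e.left_inv hxs] using hx⟩ hux
  filter_upwards [(e.continuousAt hxs).eventually hev, e.open_source.mem_nhds hxs] with x' h1 h2
  rw [← h1, hu, hG, hW, ← normSqDeTurck_symm g g' g hem (e.map_source h2), e.left_inv h2]

/-- The function `|V|²` is locally constant. -/
theorem eventually_normSqDeTurck_eq_self [CompactSpace M] (hst : IsStationary g g') (x : M) :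
    ∀ᶠ x' in 𝓝 x, normSqDeTurck g g' g x' = normSqDeTurck g g' g x := by
  have : LocallyConnectedSpace M :=
    ChartedSpace.locallyConnectedSpace (EuclideanSpace ℝ (Fin n)) M
  set C := connectedComponent x with hC
  have hCo : IsOpen C := isOpen_connectedComponent
  have hCc : IsClosed C := isClosed_connectedComponent
  have hcont := continuous_normSqDeTurck g g' g
  obtain ⟨x₀, hx₀, hmax⟩ := hCc.isCompact.exists_isMaxOn ⟨x, mem_connectedComponent⟩
    hcont.continuousOn
  -- The set where the maximum over the component is attained is open and closed.
  set S := C ∩ normSqDeTurck g g' g ⁻¹' {normSqDeTurck g g' g x₀} with hS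
  have hSclosed : IsClosed S := hCc.inter (isClosed_singleton.preimage hcont)
  have hSopen : IsOpen S := by
    rw [isOpen_iff_mem_nhds]
    rintro w ⟨hwC, hw⟩
    have hw' : normSqDeTurck g g' g w = normSqDeTurck g g' g x₀ := hw
    have := eventually_normSqDeTurck_eq hst hCo hwC fun x' hx' => by
      rw [hw']; exact hmax hx'
    filter_upwards [this, hCo.mem_nhds hwC] with x' h1 h2
    exact ⟨h2, h1.trans hw'⟩
  have hsub : C ⊆ S := isPreconnected_connectedComponent.subset_isClopen ⟨hSclosed, hSopen⟩
    ⟨x₀, hx₀, hx₀, rfl⟩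
  have hx : normSqDeTurck g g' g x = normSqDeTurck g g' g x₀ := (hsub mem_connectedComponent).2
  filter_upwards [hCo.mem_nhds mem_connectedComponent] with x' hx'
  rw [hx]
  exact (hsub hx').2

/-- The DeTurck vector field of a stationary metric is parallel. -/
theorem pderiv_coordDeTurck_eq_zero [CompactSpace M] (hst : IsStationary g g')
    (hf : f ∈ maximalAtlas (𝓡 n) ∞ M) (hz : z ∈ f.target)
    (hN : IsNormalAt (coordMetric g f) z) (a i : Fin n) :
    pderiv a (coordDeTurck g g' f i) z = 0 := by
  have hev : normSqField (coordMetric g f) (coordDeTurck g g' f)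
      =ᶠ[𝓝 z] fun _ => normSqDeTurck g g' g (f.symm z) := by
    filter_upwards [f.open_target.mem_nhds hz, (f.continuousAt_symm hz).eventually
      (eventually_normSqDeTurck_eq_self hst (f.symm z))] with w h1 h2
    rw [← h2, normSqDeTurck_symm g g' g hf h1]
  have h1 k : pderiv k (normSqField (coordMetric g f) (coordDeTurck g g' f)) =ᶠ[𝓝 z]
      fun _ => 0 := by
    filter_upwards [pderiv_eventuallyEq hev k] with w hw
    rw [hw, pderiv_const]
  have hB := bochner_of_isNormalAt hst hf hz hN
  simp only [(h1 _).self_of_nhds, pderiv_congr (h1 _), pderiv_const, Finset.sum_const_zero,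
    mul_zero, sub_zero] at hB
  have hsum : ∑ a, ∑ i, (pderiv a (coordDeTurck g g' f i) z) ^ 2 = 0 := by linarith
  have h2 := (Finset.sum_eq_zero_iff_of_nonneg fun a _ =>
    Finset.sum_nonneg fun i _ => sq_nonneg _).1 hsum a (Finset.mem_univ a)
  have h3 := (Finset.sum_eq_zero_iff_of_nonneg fun i _ => sq_nonneg _).1 h2 i (Finset.mem_univ i)
  exact pow_eq_zero_iff two_ne_zero |>.1 h3

end Parallel

/-! ### The divergence theorem -/

section DivergenceTheorem

open Filter Topology Matrix IsManifold MeasureTheory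

variable {n : ℕ}

theorem integral_pderiv_eq_zero {F : EuclideanSpace ℝ (Fin n) → ℝ} (hF : ContDiff ℝ ∞ F)
    (hc : HasCompactSupport F) (i : Fin n) : ∫ y, pderiv i F y = 0 := by
  have hF' : Continuous (pderiv i F) :=
    (hF.continuous_fderiv (by simp)).clm_apply continuous_const
  have hc' : HasCompactSupport (pderiv i F) := hc.fderiv_apply (𝕜 := ℝ) _
  have h := integral_mul_fderiv_eq_neg_fderiv_mul_of_integrable (μ := volume)
    (f := fun _ : EuclideanSpace ℝ (Fin n) => (1 : ℝ)) (g := F)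
    (v := EuclideanSpace.single i (1 : ℝ)) (by simp)
    (by simpa using! hF'.integrable_of_hasCompactSupport hc')
    (by simpa using hF.continuous.integrable_of_hasCompactSupport hc)
    (fun _ _ => differentiableAt_const _) (fun y _ => hF.contDiffAt.differentiableAt_infty)
  simpa [pderiv] using h

theorem setIntegral_pderiv_eq_zero {T K : Set (EuclideanSpace ℝ (Fin n))} (hT : IsOpen T)
    (hK : IsCompact K) (hKT : K ⊆ T) {F : EuclideanSpace ℝ (Fin n) → ℝ}
    (hF : ∀ y ∈ T, ContDiffAt ℝ ∞ F y) (hFK : ∀ y ∈ T, y ∉ K → F y = 0) (i : Fin n) :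
    ∫ y in T, pderiv i F y = 0 := by
  set H := T.indicator F with hH
  have h1 : ∀ y ∈ T, H =ᶠ[𝓝 y] F := fun y hy => by
    filter_upwards [hT.mem_nhds hy] with w hw using Set.indicator_of_mem hw F
  have hH0 : ∀ y ∉ K, H y = 0 := fun y hy => by
    by_cases hyT : y ∈ T
    · rw [hH, Set.indicator_of_mem hyT, hFK y hyT hy]
    · exact Set.indicator_of_notMem hyT F
  have h2 : ∀ y ∉ K, H =ᶠ[𝓝 y] fun _ => 0 := fun y hy => by
    filter_upwards [hK.isClosed.isOpen_compl.mem_nhds hy] with w hw using hH0 w hw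
  have hHs : ContDiff ℝ ∞ H := by
    rw [contDiff_iff_contDiffAt]
    intro y
    by_cases hy : y ∈ K
    · exact (hF y (hKT hy)).congr_of_eventuallyEq (h1 y (hKT hy))
    · exact contDiffAt_const.congr_of_eventuallyEq (h2 y hy)
  have hcompl : ∀ y ∉ T, pderiv i H y = 0 := fun y hy => by
    rw [pderiv_congr (h2 y fun hyK => hy (hKT hyK)), pderiv_const]
  calc ∫ y in T, pderiv i F y = ∫ y in T, pderiv i H y :=
        setIntegral_congr_fun hT.measurableSet fun y hy => (pderiv_congr (h1 y hy) i).symm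
    _ = ∫ y, pderiv i H y := setIntegral_eq_integral_of_forall_compl_eq_zero hcompl
    _ = 0 := integral_pderiv_eq_zero hHs (HasCompactSupport.intro hK hH0) i

theorem integrableOn_of_compact {T K : Set (EuclideanSpace ℝ (Fin n))} (hT : IsOpen T)
    (hK : IsCompact K) (hKT : K ⊆ T) {F : EuclideanSpace ℝ (Fin n) → ℝ}
    (hF : ContinuousOn F T) (hFK : ∀ y ∈ T, y ∉ K → F y = 0) : IntegrableOn F T :=
  ((hF.mono hKT).integrableOn_compact hK).of_forall_sdiff_eq_zero hT.measurableSet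
    fun y hy => hFK y hy.1 hy.2

variable {M : Type*} [TopologicalSpace M]
  [ChartedSpace (EuclideanSpace ℝ (Fin n)) M] [IsManifold (𝓡 n) ∞ M]
  {e f : OpenPartialHomeomorph M (EuclideanSpace ℝ (Fin n))} (g : Metric n M)

/-- Integrals against the Riemannian density do not depend on the chart. -/
theorem setIntegral_density_transition (he : e ∈ maximalAtlas (𝓡 n) ∞ M)
    (hf : f ∈ maximalAtlas (𝓡 n) ∞ M) {h k : EuclideanSpace ℝ (Fin n) → ℝ}
    (hhk : ∀ y ∈ e.target, e.symm y ∈ f.source → h y = k ((f ∘ e.symm) y))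
    (hh : ∀ y ∈ e.target, e.symm y ∉ f.source → h y = 0)
    (hk : ∀ w ∈ f.target, f.symm w ∉ e.source → k w = 0) :
    ∫ y in e.target, density (coordMetric g e) y * h y
      = ∫ w in f.target, density (coordMetric g f) w * k w := by
  have hU : IsOpen (e.target ∩ e.symm ⁻¹' f.source) := e.isOpen_inter_preimage_symm f.open_source
  have himage : (f ∘ e.symm) '' (e.target ∩ e.symm ⁻¹' f.source)
      = f.target ∩ f.symm ⁻¹' e.source := by
    ext w
    constructor
    · rintro ⟨y, ⟨hy, hy'⟩, rfl⟩
      refine ⟨f.map_source hy', ?_⟩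
      simp only [Set.mem_preimage, Function.comp, f.left_inv hy']
      exact e.map_target hy
    · rintro ⟨hw, hw'⟩
      refine ⟨e (f.symm w), ⟨e.map_source hw', ?_⟩, ?_⟩
      · simp only [Set.mem_preimage, e.left_inv hw', f.map_target hw]
      · simp only [Function.comp, e.left_inv hw', f.right_inv hw]
  have hinj : Set.InjOn (f ∘ e.symm) (e.target ∩ e.symm ⁻¹' f.source) := by
    rintro y ⟨hy, hy'⟩ w ⟨hw, hw'⟩ hyw
    exact e.symm.injOn hy hw (f.injOn hy' hw' hyw)
  have hd : ∀ y ∈ e.target ∩ e.symm ⁻¹' f.source, DifferentiableAt ℝ (f ∘ e.symm) y :=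
    fun y hy => (contDiffAt_transition he hf hy.1 hy.2).differentiableAt_infty
  rw [setIntegral_eq_of_subset_of_forall_sdiff_eq_zero e.open_target.measurableSet
      (Set.inter_subset_left : e.target ∩ e.symm ⁻¹' f.source ⊆ e.target)
      fun y hy => by rw [hh y hy.1 fun h' => hy.2 ⟨hy.1, h'⟩, mul_zero],
    setIntegral_eq_of_subset_of_forall_sdiff_eq_zero f.open_target.measurableSet
      (Set.inter_subset_left : f.target ∩ f.symm ⁻¹' e.source ⊆ f.target)
      fun y hy => by rw [hk y hy.1 fun h' => hy.2 ⟨hy.1, h'⟩, mul_zero],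
    ← himage, integral_image_eq_integral_abs_det_fderiv_smul volume hU.measurableSet
      (fun y hy => (hd y hy).hasFDerivAt.hasFDerivWithinAt) hinj]
  refine setIntegral_congr_fun hU.measurableSet fun y hy => ?_
  simp only [smul_eq_mul]
  rw [(isPullbackNear_transition g he hf hy.1 hy.2).density_eq, det_fderiv (hd y hy),
    hhk y hy.1 hy.2]
  ring

omit [IsManifold (𝓡 n) ∞ M] in
theorem contDiffAt_comp_symm {χ : M → ℝ} (hχ : ContMDiff (𝓡 n) 𝓘(ℝ) ∞ χ)
    (he : e ∈ maximalAtlas (𝓡 n) ∞ M) {y : EuclideanSpace ℝ (Fin n)} (hy : y ∈ e.target) :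
    ContDiffAt ℝ ∞ (fun y => χ (e.symm y)) y := by
  rw [← contMDiffAt_iff_contDiffAt]
  exact hχ.contMDiffAt.comp y (contMDiffAt_symm_of_mem_maximalAtlas he hy)

/-- The derivative of the function `χ` along the vector field with components `X`, in the chart
`e`. -/
def chartDeriv (χ : M → ℝ) (X : Fin n → EuclideanSpace ℝ (Fin n) → ℝ)
    (e : OpenPartialHomeomorph M (EuclideanSpace ℝ (Fin n))) (y : EuclideanSpace ℝ (Fin n)) : ℝ :=
  ∑ i, pderiv i (fun y => χ (e.symm y)) y * X i y

omit [ChartedSpace (EuclideanSpace ℝ (Fin n)) M] [IsManifold (𝓡 n) ∞ M] in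
theorem chartDeriv_eq_zero {χ : M → ℝ} {X : Fin n → EuclideanSpace ℝ (Fin n) → ℝ}
    {y : EuclideanSpace ℝ (Fin n)} (hy : y ∈ e.target) (hχ : e.symm y ∉ tsupport χ) :
    chartDeriv χ X e y = 0 := by
  have hev : (fun y => χ (e.symm y)) =ᶠ[𝓝 y] fun _ => 0 := by
    filter_upwards [(e.continuousAt_symm hy).eventually
      ((isClosed_tsupport χ).isOpen_compl.mem_nhds hχ)] with w hw
    exact image_eq_zero_of_notMem_tsupport hw
  simp [chartDeriv, pderiv_congr hev]

omit [IsManifold (𝓡 n) ∞ M] in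
theorem continuousOn_chartDeriv {χ : M → ℝ} (hχ : ContMDiff (𝓡 n) 𝓘(ℝ) ∞ χ)
    (he : e ∈ maximalAtlas (𝓡 n) ∞ M) {X : Fin n → EuclideanSpace ℝ (Fin n) → ℝ}
    (hX : ∀ y ∈ e.target, ∀ i, ContDiffAt ℝ ∞ (X i) y) :
    ContinuousOn (chartDeriv χ X e) e.target := fun y hy =>
  (ContDiffAt.sum fun i _ => ((contDiffAt_comp_symm hχ he hy).pderiv_infty i).mul
    (hX y hy i) : ContDiffAt ℝ ∞ (chartDeriv χ X e) y).continuousAt.continuousWithinAt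

theorem continuousOn_density (he : e ∈ maximalAtlas (𝓡 n) ∞ M) :
    ContinuousOn (density (coordMetric g e)) e.target := fun _ hy =>
  (isMetricNear_coordMetric g he hy).density_smooth.continuousAt.continuousWithinAt

omit [ChartedSpace (EuclideanSpace ℝ (Fin n)) M] [IsManifold (𝓡 n) ∞ M] in
theorem isCompact_image_tsupport [CompactSpace M] {χ : M → ℝ} (hsupp : tsupport χ ⊆ e.source) :
    IsCompact (e '' tsupport χ) :=
  (isClosed_tsupport χ).isCompact.image_of_continuousOn (e.continuousOn.mono hsupp)

omit [ChartedSpace (EuclideanSpace ℝ (Fin n)) M] [IsManifold (𝓡 n) ∞ M] in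
theorem image_tsupport_subset {χ : M → ℝ} (hsupp : tsupport χ ⊆ e.source) :
    e '' tsupport χ ⊆ e.target := by
  rintro _ ⟨x, hx, rfl⟩
  exact e.map_source (hsupp hx)

omit [ChartedSpace (EuclideanSpace ℝ (Fin n)) M] [IsManifold (𝓡 n) ∞ M] in
theorem notMem_tsupport_of_notMem_image {χ : M → ℝ} {y : EuclideanSpace ℝ (Fin n)}
    (hy : y ∈ e.target) (hyK : y ∉ e '' tsupport χ) : e.symm y ∉ tsupport χ :=
  fun h => hyK ⟨_, h, e.right_inv hy⟩

/-- The divergence theorem for a vector field cut off inside one chart. -/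
theorem setIntegral_cutoff_mul_divergence [CompactSpace M] {χ : M → ℝ}
    (hχ : ContMDiff (𝓡 n) 𝓘(ℝ) ∞ χ) (he : e ∈ maximalAtlas (𝓡 n) ∞ M)
    (hsupp : tsupport χ ⊆ e.source) {X : Fin n → EuclideanSpace ℝ (Fin n) → ℝ}
    (hX : ∀ y ∈ e.target, ∀ i, ContDiffAt ℝ ∞ (X i) y) {F : M → ℝ} (hFc : Continuous F)
    (hF : ∀ y ∈ e.target, divergence (coordMetric g e) X y = F (e.symm y)) :
    ∫ y in e.target, density (coordMetric g e) y * (χ (e.symm y) * F (e.symm y))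
      = -∫ y in e.target, density (coordMetric g e) y * chartDeriv χ X e y := by
  set ρ := density (coordMetric g e) with hρ
  have hK := isCompact_image_tsupport hsupp
  have hKT := image_tsupport_subset hsupp
  have hcχ : ContinuousOn (fun y => χ (e.symm y)) e.target :=
    hχ.continuous.comp_continuousOn e.continuousOn_symm
  have hcF : ContinuousOn (fun y => F (e.symm y)) e.target :=
    hFc.comp_continuousOn e.continuousOn_symm
  have hχK : ∀ y ∈ e.target, y ∉ e '' tsupport χ → χ (e.symm y) = 0 := fun y hy hyK =>
    image_eq_zero_of_notMem_tsupport (notMem_tsupport_of_notMem_image hy hyK)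
  have hi1 : IntegrableOn (fun y => ρ y * (χ (e.symm y) * F (e.symm y))) e.target :=
    integrableOn_of_compact e.open_target hK hKT
      ((continuousOn_density g he).mul (hcχ.mul hcF)) fun y hy hyK => by simp [hχK y hy hyK]
  have hi2 : IntegrableOn (fun y => ρ y * chartDeriv χ X e y) e.target :=
    integrableOn_of_compact e.open_target hK hKT
      ((continuousOn_density g he).mul (continuousOn_chartDeriv hχ he hX)) fun y hy hyK => by
        rw [chartDeriv_eq_zero hy (notMem_tsupport_of_notMem_image hy hyK), mul_zero]
  have hρs : ∀ y ∈ e.target, ContDiffAt ℝ ∞ ρ y := fun y hy =>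
    (isMetricNear_coordMetric g he hy).density_smooth
  set H : Fin n → EuclideanSpace ℝ (Fin n) → ℝ := fun i y => χ (e.symm y) * (ρ y * X i y) with hH
  have hHs i : ∀ y ∈ e.target, ContDiffAt ℝ ∞ (H i) y := fun y hy =>
    (contDiffAt_comp_symm hχ he hy).mul ((hρs y hy).mul (hX y hy i))
  have hHK i : ∀ y ∈ e.target, y ∉ e '' tsupport χ → H i y = 0 := fun y hy hyK => by
    simp [hH, hχK y hy hyK]
  have hi3 i : IntegrableOn (pderiv i (H i)) e.target :=
    integrableOn_of_compact e.open_target hK hKT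
      (fun y hy => ((hHs i y hy).pderiv_infty i).continuousAt.continuousWithinAt)
      fun y hy hyK => by
        have hev : H i =ᶠ[𝓝 y] fun _ => 0 := by
          filter_upwards [(e.open_target.sdiff hK.isClosed).mem_nhds ⟨hy, hyK⟩] with w hw
          exact hHK i w hw.1 hw.2
        rw [pderiv_congr hev, pderiv_const]
  have hzero : ∫ y in e.target, ∑ i, pderiv i (H i) y = 0 := by
    rw [integral_finsetSum _ fun i _ => hi3 i]
    exact Finset.sum_eq_zero fun i _ =>
      setIntegral_pderiv_eq_zero e.open_target hK hKT (hHs i) (hHK i) i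
  rw [eq_neg_iff_add_eq_zero, ← integral_add hi1 hi2, ← hzero]
  refine setIntegral_congr_fun e.open_target.measurableSet fun y hy => ?_
  have hG := isMetricNear_coordMetric g he hy
  have hXd i := (hX y hy i).differentiableAt_infty
  have hχd := (contDiffAt_comp_symm hχ he hy).differentiableAt_infty
  have hρd := (hρs y hy).differentiableAt_infty
  have h1 := hG.sum_pderiv_density_mul (X := X) hXd
  simp only [hH]
  rw [Finset.sum_congr rfl fun i _ => pderiv_mul hχd (hρd.fun_mul (hXd i)) i,
    Finset.sum_add_distrib, ← Finset.mul_sum, h1, hF y hy, chartDeriv, Finset.mul_sum, add_comm]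
  congr 1
  · exact Finset.sum_congr rfl fun i _ => by ring
  · ring

/-- A nonnegative continuous function on a compact manifold that is the divergence of a smooth
vector field vanishes. The vector field is given by its components in all charts. No orientation is
needed: the integrals are taken in charts, against the Riemannian density and a partition of
unity. -/
theorem eq_zero_of_divergence_eq [CompactSpace M] [T2Space M]
    (X : OpenPartialHomeomorph M (EuclideanSpace ℝ (Fin n)) →
      Fin n → EuclideanSpace ℝ (Fin n) → ℝ)
    (hX : ∀ e ∈ maximalAtlas (𝓡 n) ∞ M, ∀ y ∈ e.target, ∀ i, ContDiffAt ℝ ∞ (X e i) y)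
    (hXt : ∀ e ∈ maximalAtlas (𝓡 n) ∞ M, ∀ f ∈ maximalAtlas (𝓡 n) ∞ M, ∀ y ∈ e.target,
      e.symm y ∈ f.source →
        (jac (f ∘ e.symm) y *ᵥ fun k => X e k y) = fun k => X f k ((f ∘ e.symm) y))
    {F : M → ℝ} (hFc : Continuous F) (hF0 : ∀ x, 0 ≤ F x)
    (hF : ∀ e ∈ maximalAtlas (𝓡 n) ∞ M, ∀ y ∈ e.target,
      divergence (coordMetric g e) (X e) y = F (e.symm y)) (x : M) : F x = 0 := by
  obtain ⟨t, ht⟩ := isCompact_univ.elim_finite_subcover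
    (fun x : M => (chartAt (EuclideanSpace ℝ (Fin n)) x).source)
    (fun x => (chartAt (EuclideanSpace ℝ (Fin n)) x).open_source)
    fun x _ => Set.mem_iUnion.2 ⟨x, mem_chart_source _ x⟩
  set c : t → OpenPartialHomeomorph M (EuclideanSpace ℝ (Fin n)) := fun a => chartAt _ (a : M)
    with hc
  have hcm a : c a ∈ maximalAtlas (𝓡 n) ∞ M := chart_mem_maximalAtlas _
  obtain ⟨χ, hχ⟩ := SmoothPartitionOfUnity.exists_isSubordinate (𝓡 n) (s := (Set.univ : Set M))
    isClosed_univ (fun a => (c a).source) (fun a => (c a).open_source) fun x hx => by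
      obtain ⟨a, ha, hxa⟩ := Set.mem_iUnion₂.1 (ht hx)
      exact Set.mem_iUnion.2 ⟨⟨a, ha⟩, hxa⟩
  have hχs a : ContMDiff (𝓡 n) 𝓘(ℝ) ∞ (χ a) := (χ a).contMDiff
  have hsupp a : tsupport (χ a) ⊆ (c a).source := hχ a
  have hsum x : ∑ a, χ a x = 1 := by
    have := χ.sum_eq_one (Set.mem_univ x)
    rwa [finsum_eq_sum_of_fintype] at this
  set ρ := fun a => density (coordMetric g (c a)) with hρ
  have hcχ a b : ContinuousOn (fun y => χ b ((c a).symm y)) (c a).target :=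
    (hχs b).continuous.comp_continuousOn (c a).continuousOn_symm
  -- Inserting `1 = ∑ χ` into the boundary terms gives integrals that can be moved between charts.
  have hint a b d : (a = b ∨ a = d) → IntegrableOn (fun y => ρ a y *
      (χ b ((c a).symm y) * chartDeriv (χ d) (X (c a)) (c a) y)) (c a).target := by
    intro h
    refine integrableOn_of_compact (c a).open_target (isCompact_image_tsupport (hsupp a))
      (image_tsupport_subset (hsupp a)) ((continuousOn_density g (hcm a)).mul ((hcχ a b).mul
        (continuousOn_chartDeriv (hχs d) (hcm a) (hX _ (hcm a))))) fun y hy hyK => ?_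
    have hy' := notMem_tsupport_of_notMem_image hy hyK
    rcases h with rfl | rfl
    · simp [image_eq_zero_of_notMem_tsupport hy']
    · simp [chartDeriv_eq_zero hy hy']
  have hmove a b : ∫ y in (c a).target, ρ a y *
        (χ b ((c a).symm y) * chartDeriv (χ a) (X (c a)) (c a) y)
      = ∫ y in (c b).target, ρ b y *
        (χ b ((c b).symm y) * chartDeriv (χ a) (X (c b)) (c b) y) := by
    refine setIntegral_density_transition g (hcm a) (hcm b) (fun y hy hy' => ?_)
      (fun y hy hy' => ?_) fun w hw hw' => ?_
    · have hleft : (c b).symm ((c b ∘ (c a).symm) y) = (c a).symm y := (c b).left_inv hy'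
      have hev : (fun y => χ a ((c a).symm y))
          =ᶠ[𝓝 y] fun y => χ a ((c b).symm ((c b ∘ (c a).symm) y)) := by
        filter_upwards [eventually_mem_overlap hy hy'] with w hw
        simp only [Function.comp, (c b).left_inv hw.2]
      have hφ := contDiffAt_transition (hcm a) (hcm b) hy hy'
      have hχd := (contDiffAt_comp_symm (hχs a) (hcm b)
        (y := (c b ∘ (c a).symm) y) ((c b).map_source hy')).differentiableAt_infty
      rw [hleft]
      congr 1
      have hX' k := congrFun (hXt _ (hcm a) _ (hcm b) y hy hy') k
      simp only [Matrix.mulVec, dotProduct] at hX'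
      simp only [chartDeriv, ← hX', Finset.mul_sum]
      rw [Finset.sum_comm]
      refine Finset.sum_congr rfl fun i _ => ?_
      rw [pderiv_congr hev, pderiv_comp (f := fun y => χ a ((c b).symm y)) hχd
        hφ.differentiableAt_infty, Finset.sum_mul]
      exact Finset.sum_congr rfl fun k _ => by simp only [jac, Matrix.of_apply]; ring
    · rw [image_eq_zero_of_notMem_tsupport fun h => hy' (hsupp b h), zero_mul]
    · rw [chartDeriv_eq_zero hw fun h => hw' (hsupp a h), mul_zero]
  -- The sum of the boundary terms is the integral of the derivative of `∑ χ = 1`.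
  have hbdry : ∑ a, ∫ y in (c a).target, ρ a y * chartDeriv (χ a) (X (c a)) (c a) y = 0 := by
    have h1 a : ∫ y in (c a).target, ρ a y * chartDeriv (χ a) (X (c a)) (c a) y
        = ∑ b, ∫ y in (c b).target, ρ b y *
          (χ b ((c b).symm y) * chartDeriv (χ a) (X (c b)) (c b) y) := by
      simp only [← hmove]
      rw [← integral_finsetSum _ fun b _ => hint a b a (Or.inr rfl)]
      refine setIntegral_congr_fun (c a).open_target.measurableSet fun y _ => ?_
      simp only [← Finset.mul_sum, ← Finset.sum_mul, hsum, one_mul]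
    simp only [h1]
    rw [Finset.sum_comm]
    refine Finset.sum_eq_zero fun b _ => ?_
    rw [← integral_finsetSum _ fun a _ => hint b b a (Or.inl rfl)]
    refine (setIntegral_congr_fun (c b).open_target.measurableSet fun y hy => ?_).trans
      (integral_zero _ _)
    have h2 : ∑ a, chartDeriv (χ a) (X (c b)) (c b) y = 0 := by
      simp only [chartDeriv]
      rw [Finset.sum_comm]
      refine Finset.sum_eq_zero fun i _ => ?_
      rw [← Finset.sum_mul, ← pderiv_sum _ fun a _ =>
        (contDiffAt_comp_symm (hχs a) (hcm b) hy).differentiableAt_infty]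
      simp only [hsum, pderiv_const, zero_mul]
    simp only [← Finset.mul_sum, h2, mul_zero]
  have hterm a : ∫ y in (c a).target, ρ a y * (χ a ((c a).symm y) * F ((c a).symm y))
      = -∫ y in (c a).target, ρ a y * chartDeriv (χ a) (X (c a)) (c a) y :=
    setIntegral_cutoff_mul_divergence g (hχs a) (hcm a) (hsupp a) (hX _ (hcm a)) hFc
      (hF _ (hcm a))
  have hpos a : ∀ y ∈ (c a).target, 0 ≤ ρ a y * (χ a ((c a).symm y) * F ((c a).symm y)) :=
    fun y hy => mul_nonneg (isMetricNear_coordMetric g (hcm a) hy).density_pos.le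
      (mul_nonneg (χ.nonneg a _) (hF0 _))
  have htotal : ∑ a, ∫ y in (c a).target, ρ a y * (χ a ((c a).symm y) * F ((c a).symm y)) = 0 := by
    simp only [hterm, Finset.sum_neg_distrib, hbdry, neg_zero]
  have heach a : ∫ y in (c a).target, ρ a y * (χ a ((c a).symm y) * F ((c a).symm y)) = 0 :=
    (Finset.sum_eq_zero_iff_of_nonneg fun a _ =>
      setIntegral_nonneg (c a).open_target.measurableSet (hpos a)).1 htotal a (Finset.mem_univ a)
  have hprod a : χ a x * F x = 0 := by
    by_cases hx : x ∈ (c a).source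
    · have hcont : ContinuousOn (fun y => ρ a y * (χ a ((c a).symm y) * F ((c a).symm y)))
          (c a).target := (continuousOn_density g (hcm a)).mul
            ((hcχ a a).mul (hFc.comp_continuousOn (c a).continuousOn_symm))
      have hi := integrableOn_of_compact (c a).open_target (isCompact_image_tsupport (hsupp a))
        (image_tsupport_subset (hsupp a)) hcont fun y hy hyK => by
          rw [image_eq_zero_of_notMem_tsupport (notMem_tsupport_of_notMem_image hy hyK), zero_mul,
            mul_zero]
      have hae := (setIntegral_eq_zero_iff_of_nonneg_ae
        ((ae_restrict_iff' (c a).open_target.measurableSet).2 (ae_of_all _ (hpos a))) hi).1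
        (heach a)
      have hzero := Measure.eqOn_open_of_ae_eq hae (c a).open_target hcont continuousOn_const
        ((c a).map_source hx)
      simp only [(c a).left_inv hx, Pi.zero_apply] at hzero
      exact (mul_eq_zero.1 hzero).resolve_left
        (isMetricNear_coordMetric g (hcm a) ((c a).map_source hx)).density_pos.ne'
    · rw [image_eq_zero_of_notMem_tsupport fun h => hx (hsupp a h), zero_mul]
  calc F x = (∑ a, χ a x) * F x := by rw [hsum, one_mul]
    _ = 0 := by rw [Finset.sum_mul]; exact Finset.sum_eq_zero fun a _ => hprod a

end DivergenceTheorem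

/-! ### Vanishing of the DeTurck vector field -/

section Vanishing

open Filter Topology Matrix IsManifold

variable {n : ℕ} {M : Type*} [TopologicalSpace M]
  [ChartedSpace (EuclideanSpace ℝ (Fin n)) M] [IsManifold (𝓡 n) ∞ M]
  {e f : OpenPartialHomeomorph M (EuclideanSpace ℝ (Fin n))}
  {y z : EuclideanSpace ℝ (Fin n)} (g g' : Metric n M)

/-- The components in the chart `e` of the stress-energy vector field of the DeTurck field. -/
def coordStress (e : OpenPartialHomeomorph M (EuclideanSpace ℝ (Fin n))) :
    Fin n → EuclideanSpace ℝ (Fin n) → ℝ :=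
  stressField (coordMetric g e) (coordMetric g' e) (coordDeTurck g g' e)

theorem contDiffAt_coordStress (he : e ∈ maximalAtlas (𝓡 n) ∞ M) (hy : y ∈ e.target)
    (k : Fin n) : ContDiffAt ℝ ∞ (coordStress g g' e k) y :=
  stressField_smooth (isMetricNear_coordMetric g he hy) (isMetricNear_coordMetric g' he hy)
    (contDiffAt_coordDeTurck g g' he hy) k

theorem jac_mulVec_coordStress (hf : f ∈ maximalAtlas (𝓡 n) ∞ M)
    (he : e ∈ maximalAtlas (𝓡 n) ∞ M) (hz : z ∈ f.target) (hz' : f.symm z ∈ e.source) :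
    (jac (e ∘ f.symm) z *ᵥ fun k => coordStress g g' f k z)
      = fun k => coordStress g g' e k ((e ∘ f.symm) z) :=
  IsPullbackNear.stressField_eq (isPullbackNear_transition g hf he hz hz')
    (isPullbackNear_transition g' hf he hz hz').eq_self
    (jac_mulVec_coordDeTurck g g' hf he hz hz')

variable {g g'}

/-- For a stationary metric, the divergence of the stress-energy vector field is the squared length
of the DeTurck field in the reference metric. Both sides are compared in normal coordinates. -/
theorem divergence_coordStress [CompactSpace M] (hst : IsStationary g g')
    (he : e ∈ maximalAtlas (𝓡 n) ∞ M) (hy : y ∈ e.target) :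
    divergence (coordMetric g e) (coordStress g g' e) y = normSqDeTurck g g' g' (e.symm y) := by
  obtain ⟨f, hf, z, hz, hzy, hN⟩ := exists_isNormalAt g he hy
  have hz' : f.symm z ∈ e.source := by rw [hzy]; exact e.map_target hy
  have hφz : (e ∘ f.symm) z = y := by simp [hzy, e.right_inv hy]
  have hP := isPullbackNear_transition g hf he hz hz'
  have hdiv := hP.divergence_eq hN (X := coordStress g g' f) (Y := coordStress g g' e)
    (fun i => (contDiffAt_coordStress g g' hf hz i).differentiableAt_infty)
    (fun i => (contDiffAt_coordStress g g' he (hφz ▸ hy) i).differentiableAt_infty) (by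
      filter_upwards [eventually_mem_overlap hz hz'] with w hw k
      exact (congrFun (jac_mulVec_coordStress g g' hf he hw.1 hw.2) k).symm)
  rw [hφz] at hdiv
  rw [← hdiv, ← hzy, normSqDeTurck_symm g g' g' hf hz]
  exact hN.divergence_stressField (isMetricNear_coordMetric g hf hz)
    (isMetricNear_coordMetric g' hf hz)
    fun i a => pderiv_coordDeTurck_eq_zero hst hf hz hN a i

theorem normSqDeTurck_eq_zero [T2Space M] [CompactSpace M] (hst : IsStationary g g') (x : M) :
    normSqDeTurck g g' g' x = 0 := by
  refine eq_zero_of_divergence_eq g (coordStress g g')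
    (fun e he y hy i => contDiffAt_coordStress g g' he hy i)
    (fun e he f hf y hy hy' => jac_mulVec_coordStress g g' he hf hy hy')
    (continuous_normSqDeTurck g g' g') (fun x' => ?_)
    (fun e he y hy => divergence_coordStress hst he hy) x
  have h := (posDef_coordMetric g' (chart_mem_maximalAtlas x')
    (mem_chart_target _ x')).posSemidef.dotProduct_mulVec_nonneg
      fun k => coordDeTurck g g' (chartAt _ x') k (chartAt _ x' x')
  rw [star_trivial, ← normSqField_eq_dotProduct] at h
  exact h

theorem deTurckVectorVanishes_of_isStationary [T2Space M] [CompactSpace M]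
    (hst : IsStationary g g') : DeTurckVectorVanishes g g' := by
  intro e he y hy k
  have h := normSqDeTurck_eq_zero hst (e.symm y)
  rw [normSqDeTurck_symm g g' g' he hy, normSqField_eq_dotProduct] at h
  by_contra hk
  have hpos := (posDef_coordMetric g' he hy).dotProduct_mulVec_pos
    (x := fun k => coordDeTurck g g' e k y) fun h0 => hk (congrFun h0 k)
  rw [star_trivial, h] at hpos
  exact lt_irrefl _ hpos

end Vanishing

end RicciDeTurck

end

theorem proposition2 (n : ℕ) (M : Type*) [TopologicalSpace M] [T2Space M] [CompactSpace M]
    [ChartedSpace (EuclideanSpace ℝ (Fin n)) M] [IsManifold (𝓡 n) ∞ M]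
    (g g' : RicciDeTurck.Metric n M) (hg : RicciDeTurck.IsStationary g g') :
    RicciDeTurck.DeTurckVectorVanishes g g' :=
  RicciDeTurck.deTurckVectorVanishes_of_isStationary hg
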